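/- Let $N\ge 1$ and $m$ be integers and $\alpha,\gamma$ real numbers with $$0\le m\le N,\qquad 0<\gamma<N,\qquad 0<\alpha\le \frac{2}{\gamma+m}.$$ Put $\Omega=\{x\in\mathbb R^N:\ x_1>0,\dots,x_m>0\}$ (so $\Omega=\mathbb R^N$ if $m=0$), and let $C_0(\mathbb R^N)$ be the space of continuous real functions on $\mathbb R^N$ that tend to $0$ at infinity, with the sup norm. A function on $\mathbb R^N$ is called anti-symmetric if, for each $i=1,\dots,m$, it changes sign under $x_i\mapsto -x_i$ (almost everywhere, for a function defined up to null sets; no condition if $m=0$). Let $G_t(x)=(4\pi t)^{-N/2}e^{-|x|^2/(4t)}$ and $e^{t\Delta}\varphi=G_t\star\varphi$ for $t>0$, and let $(D_\lambda g)(x)=g(\lambda x)$. For $u_0\in C_0(\mathbb R^N)$ let $T_{\max}(u_0)\in(0,\infty]$ be the maximal existence time of the solution $u\in C([0,T_{\max}(u_0)),C_0(\mathbb R^N))$ of $$u(t)=e^{t\Delta}u_0+\int_0^t e^{(t-\sigma)\Delta}\big[|u(\sigma)|^\alpha u(\sigma)\big]\,d\sigma ,$$ the integral form of $u_t=\Delta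 u+|u|^\alpha u$, $u(0)=u_0$. Let $u_0,f\in C_0(\mathbb R^N)$ be anti-symmetric with $u_0(x)\ge f(x)\ge 0$ for $x\in\Omega$, and suppose that for some $K>0$ $$f(x)\le K\,x_1x_2\cdots x_m\,|x|^{-\gamma-2m},\qquad x\in\Omega,\ x\ne 0 .$$ Suppose that there are a sequence $\lambda_n\to\infty$ and an anti-symmetric $z\in L^1_{\rm loc}(\mathbb R^N\setminus\{0\})$, $z\not\equiv 0$, such that $$\lambda_n^{\gamma+m}\,D_{\lambda_n}f_{|\Omega}\to z_{|\Omega}\quad\text{in }\mathcal D'(\Omega)\text{ as }n\to\infty .$$ If $\alpha=2/(\gamma+m)$, assume in addition that $$\|e^{\Delta}z\|_{L^\infty(\mathbb R^N)}>\Big(\frac1\alpha\Big)^{1/\alpha},$$ where $e^{\Delta}z=G_1\star z$ and $z$ is regarded as the tempered distribution $$\langle z,\varphi\rangle=\int_\Omega z(y)\sum_{s\subseteq\{1,\dots,m\}}(-1)^{|s|}\varphi(R_sy)\,dy,$$ $R_s$ being the map that changes the sign of the coordinates $y_i$, $i\in s$ (this is $\int_{\mathbb R^N}z\varphi$ whenever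 $z\varphi$ is integrable). Then $T_{\max}(u_0)<\infty$. -/

import Mathlib

open MeasureTheory Filter Topology
open scoped ZeroAtInfty Distributions ENNReal

noncomputable section

/-- The Euclidean space `ℝ^N`. -/
abbrev RN (N : ℕ) : Type := EuclideanSpace ℝ (Fin N)

/-- The indices of the first `m` coordinates `x_1, …, x_m` of `ℝ^N`. -/
def firstIdx (N m : ℕ) : Finset (Fin N) := Finset.univ.filter (fun i => (i : ℕ) < m)

/-- The sector `Ω = {x ∈ ℝ^N : x_1 > 0, …, x_m > 0}`; it is the whole of `ℝ^N` if `m = 0`. -/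
def sector (N m : ℕ) : TopologicalSpace.Opens (RN N) where
  carrier := {x | ∀ i ∈ firstIdx N m, 0 < x i}
  is_open' := by
    have h : {x : RN N | ∀ i ∈ firstIdx N m, 0 < x i}
        = ⋂ i ∈ firstIdx N m, {x : RN N | 0 < x i} := by
      ext x; simp
    rw [h]
    exact isOpen_biInter_finset (fun i _ => isOpen_lt continuous_const (by fun_prop))

/-- Change the sign of the coordinates of `x` whose index lies in `s`. -/
def reflect {N : ℕ} (s : Finset (Fin N)) (x : RN N) : RN N :=
  WithLp.toLp 2 (fun j => if j ∈ s then - x j else x j)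

/-- `g` is anti-symmetric in `x_1, …, x_m`: `T_1 g = ⋯ = T_m g = -g` everywhere. -/
def AntiSymm {N : ℕ} (m : ℕ) (g : RN N → ℝ) : Prop :=
  ∀ i ∈ firstIdx N m, ∀ x, g (reflect {i} x) = - g x

/-- Anti-symmetry in `x_1, …, x_m` of a function that is defined up to null sets. -/
def AEAntiSymm {N : ℕ} (m : ℕ) (g : RN N → ℝ) : Prop :=
  ∀ i ∈ firstIdx N m, ∀ᵐ x ∂(volume : Measure (RN N)), g (reflect {i} x) = - g x

/-- The Gauss kernel `G_t(x) = (4πt)^{-N/2} exp(-|x|²/(4t))`, for `t > 0`. -/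
def gaussKernel {N : ℕ} (t : ℝ) (x : RN N) : ℝ :=
  (4 * Real.pi * t) ^ (-(N : ℝ) / 2) * Real.exp (-‖x‖ ^ 2 / (4 * t))

/-- The heat semigroup `e^{tΔ} φ = G_t ⋆ φ` on functions, for `t > 0`. -/
def heat {N : ℕ} (t : ℝ) (φ : RN N → ℝ) (x : RN N) : ℝ :=
  ∫ y, gaussKernel t (x - y) * φ y

/-- `u` is a solution in `C([0,T), C₀(ℝ^N))` of the integral equation
`u(t) = e^{tΔ} u₀ + a ∫_0^t e^{(t-σ)Δ} (|u(σ)|^α u(σ)) dσ` with initial value `u₀`.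
(The end point `σ = t` of the interval of integration is a null set.) -/
def IsSolution {N : ℕ} (a α : ℝ) (u₀ : C₀(RN N, ℝ)) (T : ℝ≥0∞) (u : ℝ → C₀(RN N, ℝ)) : Prop :=
  u 0 = u₀ ∧
  ContinuousOn u {t : ℝ | 0 ≤ t ∧ ENNReal.ofReal t < T} ∧
  ∀ t : ℝ, 0 < t → ENNReal.ofReal t < T → ∀ x : RN N,
    u t x = heat t u₀ x
      + a * ∫ σ in (0 : ℝ)..t, heat (t - σ) (fun y => |u σ y| ^ α * u σ y) x

/-- The maximal existence time `T_max(u₀) ∈ [0, ∞]`: the supremum of all `T` for which there is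
a solution in `C([0,T), C₀(ℝ^N))` with initial value `u₀`. -/
def maximalTime {N : ℕ} (a α : ℝ) (u₀ : C₀(RN N, ℝ)) : ℝ≥0∞ :=
  sSup {T : ℝ≥0∞ | ∃ u : ℝ → C₀(RN N, ℝ), IsSolution a α u₀ T u}

/-- The dilation operator `(D_l g)(x) = g(l x)`. -/
def dilate {N : ℕ} (l : ℝ) (g : RN N → ℝ) (x : RN N) : ℝ := g (l • x)

/-- Convergence `g_n → z` in `𝒟'(Ω)` of a sequence of functions, i.e. convergence of
`∫_Ω g_n φ` to `∫_Ω z φ` for every test function `φ` on `Ω`. -/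
def TendstoDistrib {N : ℕ} (Ω : TopologicalSpace.Opens (RN N)) (g : ℕ → RN N → ℝ)
    (z : RN N → ℝ) : Prop :=
  ∀ φ : 𝓓(Ω, ℝ), Tendsto (fun n => ∫ x in (Ω : Set (RN N)), g n x * φ x) atTop
    (𝓝 (∫ x in (Ω : Set (RN N)), z x * φ x))

/-- `∑_s (-1)^{|s|} φ(reflect s y)`, the sum over all sets `s` of indices among `1, …, m`. -/
def antiSymmSum {N : ℕ} (m : ℕ) (φ : RN N → ℝ) (y : RN N) : ℝ :=
  ∑ s ∈ (firstIdx N m).powerset, (-1 : ℝ) ^ s.card * φ (reflect s y)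

/-- The pairing with `φ` of the tempered distribution on `ℝ^N` given by an anti-symmetric
function `z` that may be singular at the origin. It is `∫_{ℝ^N} z φ` with the integral folded
onto `Ω` by anti-symmetry: for smooth `φ` the sum vanishes on the coordinate hyperplanes
`y_i = 0`, `i ≤ m`, so the integral converges absolutely as soon as
`|z| ≤ K x_1 ⋯ x_m |x|^{-γ-2m}` on `Ω` with `γ < N`, even if `z` is not locally integrable
at `0`. -/
def antiSymmPairing {N : ℕ} (m : ℕ) (z φ : RN N → ℝ) : ℝ :=
  ∫ y in (sector N m : Set (RN N)), z y * antiSymmSum m φ y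

/-- `e^{tΔ} z = G_t ⋆ z`, i.e. `(e^{tΔ} z)(x) = ⟨z, G_t(x - ·)⟩`, for the tempered distribution
given by the anti-symmetric function `z`. -/
def heatDistrib {N : ℕ} (m : ℕ) (t : ℝ) (z : RN N → ℝ) (x : RN N) : ℝ :=
  antiSymmPairing m z (fun y => gaussKernel t (x - y))

end

/-! ### Gauss kernel and the heat semigroup -/

section GaussKernel

variable {N : ℕ}

/-! The proof plays a necessary condition for existence against parabolic scaling.

On functions anti-symmetric in the coordinates of `J`, the heat semigroup acts on the orthant
through its Dirichlet kernel `orthantKernel`, which is positive and of mass at most one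
(`heat_eq_setIntegral_orthant`, `orthantKernel_pos`, `setIntegral_orthantKernel_le_one`). A solution
stays anti-symmetric and stays nonnegative on the orthant. For fixed `t` and `x` in the orthant,
Jensen's inequality then shows that `v(s) = e^{(t-s)Δ}u(s)(x)` satisfies, in integral form, `v' ≥
v^{1+α}`. Such a `v` cannot live longer than `1/(α v(0)^α)`, so existence beyond time `t` forces `α
t (e^{tΔ}u₀(x))^α ≤ 1` (`IsSolution.mul_rpow_heat_le_one`).

Since `u₀ ≥ f` on the orthant, the same bound holds for `f`. Take `t = λ_n²` and the point `λ_n x`.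
Scaling gives `λ_n^{γ+m} e^{λ_n²Δ}f(λ_n x) = e^Δ(λ_n^{γ+m} D_{λ_n}f)(x)`, which tends to `L =
e^Δz(x) > 0`. The bound would therefore require `λ_n^{2-(γ+m)α} α c_n^α ≤ 1` with `c_n → L`. This
fails for large `n`: below the critical exponent the power of `λ_n` diverges, and at it `x` can be
chosen with `α L^α > 1`.

Distributional convergence must be tested against a kernel that is not compactly supported in the
sector, and `z` may fail to be integrable at the origin. Both are handled by the homogeneous
majorant `profile`: the Dirichlet kernel vanishes to first order on each wall, so `profile` times
the kernel is at most a constant times `|y|^{-γ}` times a Gaussian, integrable because `γ < N`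
(`profile_mul_orthantKernel_le`, `tendsto_setIntegral_mul_of_tendstoDistrib`). -/

theorem gaussKernel_pos {t : ℝ} (ht : 0 < t) (x : RN N) : 0 < gaussKernel t x := by
  unfold gaussKernel
  have : 0 < 4 * Real.pi * t := by positivity
  positivity

theorem gaussKernel_neg (t : ℝ) (x : RN N) : gaussKernel t (-x) = gaussKernel t x := by
  simp [gaussKernel]

theorem gaussKernel_sub_comm (t : ℝ) (x y : RN N) :
    gaussKernel t (x - y) = gaussKernel t (y - x) := by
  rw [← gaussKernel_neg, neg_sub]

theorem measurable_gaussKernel : Measurable fun p : ℝ × RN N => gaussKernel p.1 p.2 := by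
  unfold gaussKernel
  fun_prop

theorem measurable_gaussKernel_sub (t : ℝ) (x : RN N) :
    Measurable fun y : RN N => gaussKernel t (x - y) := by
  unfold gaussKernel
  fun_prop

theorem integral_exp_neg_mul_sq_norm_sub {b : ℝ} (hb : 0 < b) (p : RN N) :
    ∫ y : RN N, Real.exp (-b * ‖y - p‖ ^ 2) = (Real.pi / b) ^ ((N : ℝ) / 2) := by
  rw [integral_sub_right_eq_self (fun y : RN N => Real.exp (-b * ‖y‖ ^ 2)) p,
    GaussianFourier.integral_rexp_neg_mul_sq_norm hb]
  simp

theorem integral_gaussKernel_sub {t : ℝ} (ht : 0 < t) (x : RN N) :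
    ∫ y, gaussKernel t (x - y) = 1 := by
  have h : ∀ y : RN N, gaussKernel t (x - y)
      = (4 * Real.pi * t) ^ (-(N : ℝ) / 2) * Real.exp (-(1 / (4 * t)) * ‖y - x‖ ^ 2) := by
    intro y
    rw [gaussKernel_sub_comm, gaussKernel]
    congr 2
    ring
  simp_rw [h]
  rw [integral_const_mul, integral_exp_neg_mul_sq_norm_sub (by positivity),
    show Real.pi / (1 / (4 * t)) = 4 * Real.pi * t by field_simp,
    ← Real.rpow_add (by positivity)]
  rw [show -(N : ℝ) / 2 + (N : ℝ) / 2 = 0 by ring, Real.rpow_zero]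

theorem integrable_gaussKernel_sub {t : ℝ} (ht : 0 < t) (x : RN N) :
    Integrable fun y => gaussKernel t (x - y) :=
  Integrable.of_integral_ne_zero (by rw [integral_gaussKernel_sub ht]; exact one_ne_zero)

theorem integrable_gaussKernel_mul {t : ℝ} (ht : 0 < t) (x : RN N) {φ : RN N → ℝ}
    (hφ : AEStronglyMeasurable φ) {M : ℝ} (hM : ∀ y, |φ y| ≤ M) :
    Integrable fun y => gaussKernel t (x - y) * φ y :=
  (integrable_gaussKernel_sub ht x).mul_bdd hφ (ae_of_all _ hM)

theorem abs_heat_le {t : ℝ} (ht : 0 < t) (x : RN N) {φ : RN N → ℝ} {M : ℝ}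
    (hM : ∀ y, |φ y| ≤ M) : |heat t φ x| ≤ M := by
  have h := norm_integral_le_of_norm_le ((integrable_gaussKernel_sub ht x).mul_const M)
    (f := fun y => gaussKernel t (x - y) * φ y) (ae_of_all _ fun y => by
      rw [norm_mul, Real.norm_of_nonneg (gaussKernel_pos ht _).le]
      exact mul_le_mul_of_nonneg_left (hM y) (gaussKernel_pos ht _).le)
  rwa [integral_mul_const, integral_gaussKernel_sub ht, one_mul] at h

/-- The Gauss kernels form a convolution semigroup. -/
theorem integral_gaussKernel_mul_gaussKernel {a b : ℝ} (ha : 0 < a) (hb : 0 < b) (x z : RN N) :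
    ∫ y, gaussKernel a (x - y) * gaussKernel b (y - z) = gaussKernel (a + b) (x - z) := by
  -- Completing the square: `p` is the centre of the Gaussian in `y` obtained by adding the two
  -- exponents.
  set p : RN N := (b / (a + b)) • x + (a / (a + b)) • z with hp
  have hab : 0 < a + b := by positivity
  have key : ∀ y : RN N, -‖x - y‖ ^ 2 / (4 * a) + -‖y - z‖ ^ 2 / (4 * b)
      = -‖x - z‖ ^ 2 / (4 * (a + b)) + -((a + b) / (4 * a * b)) * ‖y - p‖ ^ 2 := by
    intro y
    have h1 : y - p = (b / (a + b)) • (y - x) + (a / (a + b)) • (y - z) := by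
      have : y = (b / (a + b)) • y + (a / (a + b)) • y := by
        rw [← add_smul, ← add_div, add_comm b a, div_self hab.ne', one_smul]
      rw [hp]
      nth_rewrite 1 [this]
      module
    have h2 : x - z = -(y - x) + (y - z) := by abel
    rw [h1, h2, ← neg_sub y x]
    generalize y - x = u
    generalize y - z = w
    rw [norm_neg, norm_add_sq_real, norm_add_sq_real, norm_smul, norm_smul, norm_neg,
      inner_neg_left, real_inner_smul_left, real_inner_smul_right, Real.norm_of_nonneg
      (by positivity), Real.norm_of_nonneg (by positivity)]
    field_simp
    ring
  have h : ∀ y : RN N, gaussKernel a (x - y) * gaussKernel b (y - z)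
      = ((4 * Real.pi * a) ^ (-(N : ℝ) / 2) * (4 * Real.pi * b) ^ (-(N : ℝ) / 2)
        * Real.exp (-‖x - z‖ ^ 2 / (4 * (a + b))))
        * Real.exp (-((a + b) / (4 * a * b)) * ‖y - p‖ ^ 2) := by
    intro y
    rw [mul_assoc, ← Real.exp_add, ← key, Real.exp_add, gaussKernel, gaussKernel]
    ring
  simp_rw [h]
  rw [integral_const_mul, integral_exp_neg_mul_sq_norm_sub (by positivity), gaussKernel,
    mul_right_comm]
  congr 1
  rw [show (Real.pi / ((a + b) / (4 * a * b))) ^ ((N : ℝ) / 2)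
      = ((Real.pi / ((a + b) / (4 * a * b)))⁻¹) ^ (-(N : ℝ) / 2) by
    rw [Real.inv_rpow (by positivity), ← Real.rpow_neg (by positivity)]
    congr 1
    ring]
  rw [← Real.mul_rpow (by positivity) (by positivity),
    ← Real.mul_rpow (by positivity) (by positivity)]
  congr 1
  field_simp

theorem heat_comp {a b : ℝ} (ha : 0 < a) (hb : 0 < b) {φ : RN N → ℝ}
    (hφ : Measurable φ) {M : ℝ} (hM : ∀ y, |φ y| ≤ M) (x : RN N) :
    heat a (heat b φ) x = heat (a + b) φ x := by
  unfold heat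
  simp_rw [← integral_const_mul]
  rw [integral_integral_swap]
  · refine integral_congr_ae (ae_of_all _ fun z => ?_)
    simp_rw [← mul_assoc]
    rw [integral_mul_const, integral_gaussKernel_mul_gaussKernel ha hb]
  · have hm : Measurable fun p : RN N × RN N =>
        gaussKernel a (x - p.1) * (gaussKernel b (p.1 - p.2) * φ p.2) := by
      unfold gaussKernel
      fun_prop
    have hG : Integrable (fun p : RN N × RN N =>
        gaussKernel a (x - p.1) * gaussKernel b (p.1 - p.2)) (volume.prod volume) := by
      have hm' : Measurable fun p : RN N × RN N =>
          gaussKernel a (x - p.1) * gaussKernel b (p.1 - p.2) := by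
        unfold gaussKernel
        fun_prop
      rw [integrable_prod_iff hm'.aestronglyMeasurable]
      refine ⟨ae_of_all _ fun y =>
        (integrable_gaussKernel_sub hb y).const_mul (gaussKernel a (x - y)), ?_⟩
      simp_rw [norm_mul, Real.norm_of_nonneg (gaussKernel_pos ha _).le,
        Real.norm_of_nonneg (gaussKernel_pos hb _).le, integral_const_mul,
        integral_gaussKernel_sub hb, mul_one]
      exact integrable_gaussKernel_sub ha x
    refine (hG.mul_const M).mono' hm.aestronglyMeasurable (ae_of_all _ fun p => ?_)
    simp only [Function.uncurry]
    rw [← mul_assoc, norm_mul, norm_mul, Real.norm_of_nonneg (gaussKernel_pos ha _).le,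
      Real.norm_of_nonneg (gaussKernel_pos hb _).le]
    exact mul_le_mul_of_nonneg_left (hM _)
      (mul_nonneg (gaussKernel_pos ha _).le (gaussKernel_pos hb _).le)

end GaussKernel

/-! ### Reflections, and folding integrals onto an orthant -/

section Reflect

variable {N : ℕ}

theorem reflect_apply (s : Finset (Fin N)) (x : RN N) (j : Fin N) :
    reflect s x j = if j ∈ s then -x j else x j := rfl

theorem reflect_empty (x : RN N) : reflect ∅ x = x := by
  ext j; simp [reflect_apply]

theorem reflect_reflect (s : Finset (Fin N)) (x : RN N) : reflect s (reflect s x) = x := by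
  ext j; by_cases h : j ∈ s <;> simp [reflect_apply, h]

theorem reflect_insert {s : Finset (Fin N)} {j : Fin N} (hj : j ∉ s) (x : RN N) :
    reflect (insert j s) x = reflect s (reflect {j} x) := by
  ext i
  by_cases h : i = j
  · subst h; simp [reflect_apply, hj]
  · simp [reflect_apply, h]

theorem reflect_sub (s : Finset (Fin N)) (x y : RN N) :
    reflect s (x - y) = reflect s x - reflect s y := by
  ext i
  by_cases h : i ∈ s <;> simp [reflect_apply, h]
  ring

theorem reflect_smul (s : Finset (Fin N)) (c : ℝ) (x : RN N) :
    reflect s (c • x) = c • reflect s x := by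
  ext i
  by_cases h : i ∈ s <;> simp [reflect_apply, h]

theorem norm_reflect (s : Finset (Fin N)) (x : RN N) : ‖reflect s x‖ = ‖x‖ := by
  rw [EuclideanSpace.norm_eq, EuclideanSpace.norm_eq]
  congr 1
  refine Finset.sum_congr rfl fun i _ => ?_
  by_cases h : i ∈ s <;> simp [reflect_apply, h]

theorem continuous_reflect (s : Finset (Fin N)) : Continuous (reflect s : RN N → RN N) := by
  unfold reflect
  refine (PiLp.continuous_toLp 2 _).comp (continuous_pi fun j => ?_)
  split_ifs <;> fun_prop

theorem measurePreserving_reflect (s : Finset (Fin N)) :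
    MeasurePreserving (reflect s : RN N → RN N) := by
  have h := (LinearIsometryEquiv.piLpCongrRight 2 (fun i : Fin N =>
    if i ∈ s then LinearIsometryEquiv.neg ℝ (E := ℝ) else LinearIsometryEquiv.refl ℝ ℝ)
      ).measurePreserving
  convert h using 1
  ext x i
  by_cases hi : i ∈ s <;> simp [reflect_apply, hi]

/-- `reflect s` as a homeomorphism. -/
noncomputable def reflectHomeomorph (s : Finset (Fin N)) : RN N ≃ₜ RN N where
  toFun := reflect s
  invFun := reflect s
  left_inv := reflect_reflect s
  right_inv := reflect_reflect s
  continuous_toFun := continuous_reflect s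
  continuous_invFun := continuous_reflect s

theorem measurableEmbedding_reflect (s : Finset (Fin N)) :
    MeasurableEmbedding (reflect s : RN N → RN N) :=
  (reflectHomeomorph s).measurableEmbedding

theorem gaussKernel_reflect (s : Finset (Fin N)) (t : ℝ) (x : RN N) :
    gaussKernel t (reflect s x) = gaussKernel t x := by
  simp only [gaussKernel, norm_reflect]

theorem heat_reflect (s : Finset (Fin N)) (t : ℝ) (φ : RN N → ℝ) (x : RN N) :
    heat t φ (reflect s x) = heat t (fun y => φ (reflect s y)) x := by
  unfold heat
  rw [← (measurePreserving_reflect s).integral_comp (measurableEmbedding_reflect s)]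
  simp only [← reflect_sub, gaussKernel_reflect]

theorem antiSymm_reflect {g : RN N → ℝ} {J : Finset (Fin N)}
    (hg : ∀ i ∈ J, ∀ x, g (reflect {i} x) = -g x) {s : Finset (Fin N)} (hs : s ⊆ J) (x : RN N) :
    g (reflect s x) = (-1) ^ s.card * g x := by
  induction s using Finset.induction_on generalizing x with
  | empty => simp [reflect_empty]
  | insert j s hj ih =>
    rw [reflect_insert hj, ih ((Finset.subset_insert j s).trans hs),
      hg j (hs (Finset.mem_insert_self j s)), Finset.card_insert_of_notMem hj]
    ring

/-- The set where the coordinates with index in `J` are positive. -/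
def orthant (J : Finset (Fin N)) : Set (RN N) := {x | ∀ i ∈ J, 0 < x i}

theorem orthant_insert (j : Fin N) (J : Finset (Fin N)) :
    orthant (insert j J) = orthant J ∩ {x | 0 < x j} := by
  ext x; simp [orthant, and_comm]

theorem measurableSet_orthant (J : Finset (Fin N)) : MeasurableSet (orthant J) := by
  have : orthant J = ⋂ i ∈ J, {x : RN N | 0 < x i} := by ext x; simp [orthant]
  rw [this]
  exact Finset.measurableSet_biInter _ fun i _ =>
    measurableSet_lt measurable_const (by fun_prop)

theorem ae_coord_ne_zero (j : Fin N) : ∀ᵐ x : RN N, x j ≠ 0 := by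
  have h : LinearMap.ker (EuclideanSpace.proj j : RN N →L[ℝ] ℝ).toLinearMap ≠ ⊤ := by
    intro h
    have : (EuclideanSpace.single j (1 : ℝ) : RN N) ∈
        LinearMap.ker (EuclideanSpace.proj j : RN N →L[ℝ] ℝ).toLinearMap := h ▸ trivial
    simp at this
  have h2 := Measure.addHaar_submodule (volume : Measure (RN N)) _ h
  rw [ae_iff]
  convert h2 using 2
  ext x
  simp

/-- The part with `y j < 0` is carried by the reflection in `j` onto the part with `y j > 0`; the
hyperplane between them is null. -/
theorem setIntegral_orthant_eq_insert {J : Finset (Fin N)} {j : Fin N} (hj : j ∉ J)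
    {h : RN N → ℝ} (hh : Integrable h) :
    ∫ y in orthant J, h y = ∫ y in orthant (insert j J), (h y + h (reflect {j} y)) := by
  have hm : MeasurableSet {x : RN N | 0 < x j} := measurableSet_lt measurable_const (by fun_prop)
  have h1 := integral_inter_add_sdiff (μ := volume) (s := orthant J) hm hh.integrableOn
  have h2 : ∫ y in orthant J \ {x : RN N | 0 < x j}, h y
      = ∫ y in orthant (insert j J), h (reflect {j} y) := by
    rw [← (measurePreserving_reflect {j}).setIntegral_preimage_emb
      (measurableEmbedding_reflect {j})]
    refine setIntegral_congr_set ?_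
    filter_upwards [ae_coord_ne_zero j] with y hy
    simp only [eq_iff_iff]
    change y ∈ reflect {j} ⁻¹' (orthant J \ {x : RN N | 0 < x j}) ↔ y ∈ orthant (insert j J)
    have : ∀ i ∈ J, i ≠ j := fun i hi hij => hj (hij ▸ hi)
    simp only [orthant, Set.mem_preimage, Set.mem_sdiff, Set.mem_ofPred_eq, reflect_apply,
      Finset.mem_singleton, Finset.mem_insert, forall_eq_or_imp, not_lt, if_true,
      Left.neg_nonpos_iff]
    constructor
    · rintro ⟨ha, hb⟩
      exact ⟨lt_of_le_of_ne hb hy.symm, fun i hi => by simpa [this i hi] using ha i hi⟩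
    · rintro ⟨ha, hb⟩
      exact ⟨fun i hi => by simpa [this i hi] using hb i hi, ha.le⟩
  rw [← h1, h2, orthant_insert, ← integral_add hh.integrableOn]
  exact ((measurePreserving_reflect {j}).integrable_comp_of_integrable hh).integrableOn

/-- The integral over the whole space, folded onto an orthant. -/
theorem integral_eq_setIntegral_orthant (J : Finset (Fin N)) {h : RN N → ℝ} (hh : Integrable h) :
    ∫ y, h y = ∫ y in orthant J, ∑ s ∈ J.powerset, h (reflect s y) := by
  induction J using Finset.induction_on with
  | empty => simp [orthant, reflect_empty]
  | insert j J hj ih =>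
    rw [ih, setIntegral_orthant_eq_insert hj]
    · simp only [Finset.sum_powerset_insert hj]
      refine integral_congr_ae (ae_of_all _ fun y => ?_)
      simp only
      congr 1
      refine Finset.sum_congr rfl fun s hs => ?_
      rw [reflect_insert fun h => hj (Finset.mem_powerset.1 hs h)]
    · exact integrable_finsetSum _ fun s _ =>
        (measurePreserving_reflect s).integrable_comp_of_integrable hh

/-- The walls are removed one at a time: almost every point with `x j < 0` is the mirror image of a
point where vanishing is already known. It lets `z ≢ 0` be used on the sector alone. -/
theorem ae_eq_zero_of_ae_orthant {J : Finset (Fin N)} {z : RN N → ℝ}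
    (hz : ∀ i ∈ J, ∀ᵐ x, z (reflect {i} x) = -z x)
    (h0 : ∀ᵐ x : RN N, x ∈ orthant J → z x = 0) : ∀ᵐ x : RN N, z x = 0 := by
  induction J using Finset.induction_on with
  | empty => simpa [orthant] using h0
  | insert j J hj ih =>
    refine ih (fun i hi => hz i (Finset.mem_insert_of_mem hi)) ?_
    filter_upwards [h0, hz j (Finset.mem_insert_self j J), ae_coord_ne_zero j,
      (measurePreserving_reflect {j}).quasiMeasurePreserving.ae h0] with x hx hzx hxj hrx hxJ
    rw [orthant_insert] at hx hrx
    rcases lt_or_gt_of_ne hxj with h | h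
    · rw [← neg_eq_zero, ← hzx]
      refine hrx ⟨fun i hi => ?_, ?_⟩
      · have : i ≠ j := fun hij => hj (hij ▸ hi)
        simpa [reflect_apply, this] using hxJ i hi
      · simpa [reflect_apply] using h
    · exact hx ⟨hxJ, h⟩

end Reflect

/-! ### The Dirichlet heat kernel of an orthant -/

section OrthantKernel

variable {N : ℕ}

/-- The Dirichlet heat kernel of an orthant. -/
noncomputable def orthantKernel (J : Finset (Fin N)) (t : ℝ) (x y : RN N) : ℝ :=
  ∑ s ∈ J.powerset, (-1 : ℝ) ^ s.card * gaussKernel t (x - reflect s y)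

theorem heatDistrib_eq (m : ℕ) (t : ℝ) (z : RN N → ℝ) (x : RN N) :
    heatDistrib m t z x
      = ∫ y in orthant (firstIdx N m), z y * orthantKernel (firstIdx N m) t x y := rfl

/-- The factors of the heat kernel of an orthant. -/
noncomputable def kernelFactor (J : Finset (Fin N)) (t : ℝ) (x y : RN N) (i : Fin N) : ℝ :=
  if i ∈ J then 2 * Real.sinh (x i * y i / (2 * t)) else Real.exp (x i * y i / (2 * t))

/-- The signed sum over reflections factors by coordinate. Reflected coordinates contribute `e^a -
e^{-a} = 2 sinh a`, the others `e^a`. Positivity, the two upper bounds and smoothness are all read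
off this product. -/
theorem orthantKernel_eq_prod (J : Finset (Fin N)) {t : ℝ} (ht : 0 < t) (x y : RN N) :
    orthantKernel J t x y = (4 * Real.pi * t) ^ (-(N : ℝ) / 2)
      * Real.exp (-(‖x‖ ^ 2 + ‖y‖ ^ 2) / (4 * t)) * ∏ i, kernelFactor J t x y i := by
  have hG : ∀ s : Finset (Fin N), gaussKernel t (x - reflect s y)
      = (4 * Real.pi * t) ^ (-(N : ℝ) / 2) * Real.exp (-(‖x‖ ^ 2 + ‖y‖ ^ 2) / (4 * t))
        * ∏ i, Real.exp (x i * reflect s y i / (2 * t)) := by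
    intro s
    rw [← Real.exp_sum, mul_assoc, ← Real.exp_add, gaussKernel, norm_sub_sq_real, norm_reflect]
    congr 2
    have : inner ℝ x (reflect s y) = ∑ i, x i * reflect s y i := by
      simp [PiLp.inner_apply, mul_comm]
    rw [this, ← Finset.sum_div]
    field_simp
    ring
  unfold orthantKernel
  simp_rw [hG, mul_left_comm _ (_ * _), ← Finset.mul_sum]
  congr 1
  have hs : ∏ i ∈ J, kernelFactor J t x y i
      = ∏ i ∈ J, (-Real.exp (-(x i * y i / (2 * t))) + Real.exp (x i * y i / (2 * t))) := by
    refine Finset.prod_congr rfl fun i hi => ?_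
    rw [kernelFactor, if_pos hi, Real.sinh_eq]
    ring
  -- `Finset.prod_add` expands the product of differences as a sum over subsets `s` of `J`, matching
  -- the sum over reflections term by term.
  rw [← Finset.prod_sdiff (Finset.subset_univ J), hs, Finset.prod_add, Finset.mul_sum]
  refine Finset.sum_congr rfl fun s hs => ?_
  have hsJ := Finset.mem_powerset.1 hs
  rw [← Finset.prod_sdiff (Finset.subset_univ J), ← Finset.prod_sdiff hsJ, Finset.prod_neg]
  have e1 : ∏ i ∈ Finset.univ \ J, Real.exp (x i * reflect s y i / (2 * t))
      = ∏ i ∈ Finset.univ \ J, kernelFactor J t x y i := by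
    refine Finset.prod_congr rfl fun i hi => ?_
    have hi' : i ∉ J := (Finset.mem_sdiff.1 hi).2
    rw [reflect_apply, if_neg fun h => hi' (hsJ h), kernelFactor, if_neg hi']
  have e2 : ∏ i ∈ J \ s, Real.exp (x i * reflect s y i / (2 * t))
      = ∏ i ∈ J \ s, Real.exp (x i * y i / (2 * t)) := by
    refine Finset.prod_congr rfl fun i hi => ?_
    rw [reflect_apply, if_neg (Finset.mem_sdiff.1 hi).2]
  have e3 : ∏ i ∈ s, Real.exp (x i * reflect s y i / (2 * t))
      = ∏ i ∈ s, Real.exp (-(x i * y i / (2 * t))) := by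
    refine Finset.prod_congr rfl fun i hi => ?_
    rw [reflect_apply, if_pos hi]
    congr 1
    ring
  rw [e1, e2, e3]
  ring

theorem orthantKernel_empty (t : ℝ) (x y : RN N) :
    orthantKernel ∅ t x y = gaussKernel t (x - y) := by
  simp [orthantKernel, reflect_empty]

theorem kernelFactor_pos {J : Finset (Fin N)} {t : ℝ} (ht : 0 < t) {x y : RN N}
    (hx : x ∈ orthant J) (hy : y ∈ orthant J) (i : Fin N) : 0 < kernelFactor J t x y i := by
  unfold kernelFactor
  split_ifs with h
  · have := hx i h
    have := hy i h
    have : 0 < Real.sinh (x i * y i / (2 * t)) := Real.sinh_pos_iff.2 (by positivity)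
    positivity
  · positivity

theorem orthantKernel_pos {J : Finset (Fin N)} {t : ℝ} (ht : 0 < t) {x y : RN N}
    (hx : x ∈ orthant J) (hy : y ∈ orthant J) : 0 < orthantKernel J t x y := by
  rw [orthantKernel_eq_prod J ht]
  have := Finset.prod_pos fun i (_ : i ∈ Finset.univ) => kernelFactor_pos ht hx hy i
  positivity

theorem orthantKernel_le_gaussKernel {J : Finset (Fin N)} {t : ℝ} (ht : 0 < t) {x y : RN N}
    (hx : x ∈ orthant J) (hy : y ∈ orthant J) :
    orthantKernel J t x y ≤ gaussKernel t (x - y) := by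
  rw [← orthantKernel_empty, orthantKernel_eq_prod J ht, orthantKernel_eq_prod ∅ ht]
  refine mul_le_mul_of_nonneg_left (Finset.prod_le_prod
    (fun i _ => (kernelFactor_pos ht hx hy i).le) fun i _ => ?_) (by positivity)
  simp only [kernelFactor, Finset.notMem_empty, if_false]
  split_ifs with h
  · rw [Real.sinh_eq]
    linarith [Real.exp_pos (-(x i * y i / (2 * t)))]
  · exact le_rfl

theorem two_mul_sinh_le (a : ℝ) : 2 * Real.sinh a ≤ 2 * a * Real.exp a := by
  have h1 : Real.exp (-a) = Real.exp a * Real.exp (-2 * a) := by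
    rw [← Real.exp_add]; congr 1; ring
  have h2 := Real.add_one_le_exp (-2 * a)
  rw [Real.sinh_eq, h1]
  nlinarith [Real.exp_pos a]

/-- Factorwise, `2 sinh a ≤ 2a e^a` with `a = x_i y_i / (2t)`. The factors `y_i` gained here
compensate the singularity of `profile` at the origin. -/
theorem orthantKernel_le_prod_mul {J : Finset (Fin N)} {t : ℝ} (ht : 0 < t) {x y : RN N}
    (hx : x ∈ orthant J) (hy : y ∈ orthant J) :
    orthantKernel J t x y ≤ (∏ i ∈ J, x i * y i / t) * gaussKernel t (x - y) := by
  rw [← orthantKernel_empty, orthantKernel_eq_prod J ht, orthantKernel_eq_prod ∅ ht,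
    mul_left_comm]
  refine mul_le_mul_of_nonneg_left ?_ (by positivity)
  rw [← Finset.prod_sdiff (Finset.subset_univ J), ← Finset.prod_sdiff (Finset.subset_univ J),
    mul_left_comm, ← Finset.prod_mul_distrib]
  have e : ∏ i ∈ Finset.univ \ J, kernelFactor J t x y i
      = ∏ i ∈ Finset.univ \ J, kernelFactor ∅ t x y i := by
    refine Finset.prod_congr rfl fun i hi => ?_
    simp [kernelFactor, (Finset.mem_sdiff.1 hi).2]
  rw [e]
  refine mul_le_mul_of_nonneg_left (Finset.prod_le_prod
    (fun i _ => (kernelFactor_pos ht hx hy i).le) fun i hi => ?_)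
    (Finset.prod_nonneg fun i _ => by simp only [kernelFactor, Finset.notMem_empty, if_false]; positivity)
  simp only [kernelFactor, Finset.notMem_empty, if_false, if_pos hi]
  refine (two_mul_sinh_le _).trans_eq ?_
  congr 1
  field_simp

theorem contDiff_orthantKernel (J : Finset (Fin N)) {t : ℝ} (ht : 0 < t) (x : RN N) :
    ContDiff ℝ ((⊤ : ℕ∞) : WithTop ℕ∞) (orthantKernel J t x) := by
  have h : orthantKernel J t x = fun y => (4 * Real.pi * t) ^ (-(N : ℝ) / 2)
      * Real.exp (-(‖x‖ ^ 2 + ‖y‖ ^ 2) / (4 * t)) * ∏ i, kernelFactor J t x y i :=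
    funext fun y => orthantKernel_eq_prod J ht x y
  rw [h]
  refine (contDiff_const.mul ?_).mul (contDiff_prod fun i _ => ?_)
  · have : ContDiff ℝ ((⊤ : ℕ∞) : WithTop ℕ∞) fun y : RN N => ‖y‖ ^ 2 := contDiff_norm_sq ℝ
    exact ((contDiff_const.add this).neg.div_const _).exp
  · have : ContDiff ℝ ((⊤ : ℕ∞) : WithTop ℕ∞) fun y : RN N => x i * y i / (2 * t) := by fun_prop
    unfold kernelFactor
    split_ifs
    · exact contDiff_const.mul (Real.contDiff_sinh.comp this)
    · exact this.exp

theorem continuous_orthantKernel (J : Finset (Fin N)) {t : ℝ} (ht : 0 < t) (x : RN N) :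
    Continuous (orthantKernel J t x) := (contDiff_orthantKernel J ht x).continuous

theorem integrableOn_orthantKernel (J : Finset (Fin N)) {t : ℝ} (ht : 0 < t) {x : RN N}
    (hx : x ∈ orthant J) : IntegrableOn (orthantKernel J t x) (orthant J) := by
  refine (integrable_gaussKernel_sub ht x).integrableOn.mono'
    (continuous_orthantKernel J ht x).aestronglyMeasurable
    ((ae_restrict_iff' (measurableSet_orthant J)).2 (ae_of_all _ fun y hy => ?_))
  rw [Real.norm_of_nonneg (orthantKernel_pos ht hx hy).le]
  exact orthantKernel_le_gaussKernel ht hx hy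

theorem setIntegral_orthantKernel_le_one (J : Finset (Fin N)) {t : ℝ} (ht : 0 < t) {x : RN N}
    (hx : x ∈ orthant J) : ∫ y in orthant J, orthantKernel J t x y ≤ 1 := by
  rw [← integral_gaussKernel_sub ht x]
  refine (setIntegral_mono_on (integrableOn_orthantKernel J ht hx)
    (integrable_gaussKernel_sub ht x).integrableOn (measurableSet_orthant J)
    fun y hy => orthantKernel_le_gaussKernel ht hx hy).trans
    (setIntegral_le_integral (integrable_gaussKernel_sub ht x)
      (ae_of_all _ fun y => (gaussKernel_pos ht _).le))

/-- On anti-symmetric functions the heat semigroup acts through the kernel of the orthant. -/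
theorem heat_eq_setIntegral_orthant {J : Finset (Fin N)} {t : ℝ} (ht : 0 < t) {g : RN N → ℝ}
    (hg : ∀ i ∈ J, ∀ x, g (reflect {i} x) = -g x) (hgm : AEStronglyMeasurable g) {M : ℝ}
    (hM : ∀ y, |g y| ≤ M) (x : RN N) :
    heat t g x = ∫ y in orthant J, orthantKernel J t x y * g y := by
  rw [heat, integral_eq_setIntegral_orthant J (integrable_gaussKernel_mul ht x hgm hM)]
  refine integral_congr_ae (ae_of_all _ fun y => ?_)
  simp only [orthantKernel, Finset.sum_mul]
  refine Finset.sum_congr rfl fun s hs => ?_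
  rw [antiSymm_reflect hg (Finset.mem_powerset.1 hs)]
  ring

theorem integrableOn_orthantKernel_mul {J : Finset (Fin N)} {t : ℝ} (ht : 0 < t) {x : RN N}
    (hx : x ∈ orthant J) {g : RN N → ℝ} (hgm : AEStronglyMeasurable g) {M : ℝ}
    (hM : ∀ y, |g y| ≤ M) : IntegrableOn (fun y => orthantKernel J t x y * g y) (orthant J) :=
  (integrableOn_orthantKernel J ht hx).mul_bdd hgm.restrict (ae_of_all _ hM)

/-- Replacing the coordinates of `x` by their absolute values changes the kernel by a sign. -/
theorem exists_orthantKernel_eq_sign_mul (J : Finset (Fin N)) {t : ℝ} (ht : 0 < t) (x : RN N)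
    (hx : ∀ i ∈ J, x i ≠ 0) : ∃ x' ∈ orthant J, ∃ ε : ℝ, |ε| = 1 ∧
      ∀ y, orthantKernel J t x y = ε * orthantKernel J t x' y := by
  classical
  set s := J.filter fun i => x i < 0 with hs
  refine ⟨reflect s x, fun i hi => ?_, (-1) ^ s.card, by simp, fun y => ?_⟩
  · rw [reflect_apply]
    have := hx i hi
    by_cases h : x i < 0
    · rw [if_pos (by simp [hs, hi, h])]; linarith
    · rw [if_neg (by simp [hs, h])]
      exact lt_of_le_of_ne (not_lt.1 h) this.symm
  · rw [orthantKernel_eq_prod J ht, orthantKernel_eq_prod J ht, norm_reflect]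
    have h1 : ∀ i, kernelFactor J t (reflect s x) y i
        = (if i ∈ s then -1 else 1) * kernelFactor J t x y i := by
      intro i
      by_cases h : i ∈ s
      · have hi : i ∈ J := (Finset.mem_filter.1 h).1
        simp [kernelFactor, reflect_apply, h, hi, neg_div, Real.sinh_neg]
      · simp [kernelFactor, reflect_apply, h]
    have h2 : ∏ i : Fin N, (if i ∈ s then (-1 : ℝ) else 1) = (-1) ^ s.card := by
      rw [Finset.prod_ite_mem, Finset.univ_inter, Finset.prod_const]
    simp_rw [h1]
    rw [Finset.prod_mul_distrib, h2]
    have h3 : ((-1 : ℝ) ^ s.card) * (-1) ^ s.card = 1 := by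
      rw [← mul_pow]; simp
    linear_combination (-((4 * Real.pi * t) ^ (-(N : ℝ) / 2)
      * Real.exp (-(‖x‖ ^ 2 + ‖y‖ ^ 2) / (4 * t)) * ∏ i, kernelFactor J t x y i)) * h3

end OrthantKernel

/-! ### Elementary inequalities for the nonlinearity -/

section PowerNonlinearity

/-- Convexity of `b ↦ b^{1+α}`: the graph lies above its tangent at `a`. It is Bernoulli's
inequality for the ratio `b / a`, and serves both Jensen's inequality and the Lipschitz bound. -/
theorem rpow_one_add_ge_tangent {α a b : ℝ} (hα : 0 < α) (ha : 0 ≤ a) (hb : 0 ≤ b) :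
    a ^ α * a + (1 + α) * a ^ α * (b - a) ≤ b ^ α * b := by
  rcases ha.eq_or_lt with rfl | ha
  · rw [Real.zero_rpow hα.ne']
    have := Real.rpow_nonneg hb α
    nlinarith
  · have h := one_add_mul_self_le_rpow_one_add (s := b / a - 1) (p := 1 + α)
      (by have : 0 ≤ b / a := by positivity
          linarith) (by linarith)
    rw [add_sub_cancel, Real.div_rpow hb ha.le, le_div_iff₀ (by positivity), add_comm 1 α,
      Real.rpow_add_one' hb (by positivity), Real.rpow_add_one' ha.le (by positivity)] at h
    refine le_trans (le_of_eq ?_) h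
    field_simp
    ring

/-- For equal signs, use the tangent at the point of larger modulus; for opposite signs, bound each
term by `M ^ α` times its modulus. -/
theorem abs_rpow_mul_self_sub_le {α M : ℝ} (hα : 0 < α) {a b : ℝ} (ha : |a| ≤ M) (hb : |b| ≤ M) :
    |(|a| ^ α * a) - |b| ^ α * b| ≤ (1 + α) * M ^ α * |a - b| := by
  wlog hab : b ≤ a generalizing a b
  · rw [abs_sub_comm, abs_sub_comm a b]
    exact this hb ha (le_of_not_ge hab)
  have pa : |a| ^ α ≤ M ^ α := Real.rpow_le_rpow (abs_nonneg a) ha hα.le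
  have pb : |b| ^ α ≤ M ^ α := Real.rpow_le_rpow (abs_nonneg b) hb hα.le
  have na := Real.rpow_nonneg (abs_nonneg a) α
  have nb := Real.rpow_nonneg (abs_nonneg b) α
  rw [abs_of_nonneg (sub_nonneg.2 hab)]
  have hab' := sub_nonneg.2 hab
  have hM : 0 ≤ M ^ α := na.trans pa
  rcases le_total 0 b with h0 | h0
  · have h0a := h0.trans hab
    rw [abs_of_nonneg h0, abs_of_nonneg h0a] at *
    have h1 := rpow_one_add_ge_tangent hα h0a h0
    have h2 : b ^ α ≤ a ^ α := Real.rpow_le_rpow h0 hab hα.le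
    rw [abs_of_nonneg (by nlinarith)]
    nlinarith [mul_le_mul_of_nonneg_right pa hab']
  · rcases le_total a 0 with h0a | h0a
    · rw [abs_of_nonpos h0, abs_of_nonpos h0a] at *
      have h1 := rpow_one_add_ge_tangent hα (neg_nonneg.2 h0) (neg_nonneg.2 h0a)
      have h2 : (-a) ^ α ≤ (-b) ^ α := Real.rpow_le_rpow (neg_nonneg.2 h0a) (by linarith) hα.le
      rw [abs_of_nonneg (by nlinarith)]
      nlinarith [mul_le_mul_of_nonneg_right pb hab']
    · have e1 : 0 ≤ |a| ^ α * a := by positivity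
      have e2 : |b| ^ α * b ≤ 0 := mul_nonpos_of_nonneg_of_nonpos nb h0
      rw [abs_of_nonneg (by linarith)]
      have e3 : |a| ^ α * a ≤ M ^ α * a := mul_le_mul_of_nonneg_right pa h0a
      have e4 : M ^ α * b ≤ |b| ^ α * b := mul_le_mul_of_nonpos_right pb h0
      have e5 : 0 ≤ α * (M ^ α * (a - b)) := by positivity
      linarith

theorem abs_abs_rpow_mul_self_le {α M : ℝ} (hα : 0 < α) {a : ℝ} (ha : |a| ≤ M) :
    |(|a| ^ α * a)| ≤ M ^ α * M := by
  rw [abs_mul, abs_of_nonneg (Real.rpow_nonneg (abs_nonneg a) α)]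
  have hM := (abs_nonneg a).trans ha
  exact mul_le_mul (Real.rpow_le_rpow (abs_nonneg a) ha hα.le) ha (abs_nonneg a)
    (Real.rpow_nonneg hM α)

/-- The one-sided bound that closes the Gronwall argument for positivity: an estimate on the
negative part of `a` alone controls the source from below. -/
theorem neg_mul_le_abs_rpow_mul_self {α M b : ℝ} (hα : 0 < α) {a : ℝ} (ha : |a| ≤ M)
    (hb : 0 ≤ b) (hab : -a ≤ b) : -(M ^ α * b) ≤ |a| ^ α * a := by
  have pa : |a| ^ α ≤ M ^ α := Real.rpow_le_rpow (abs_nonneg a) ha hα.le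
  have na := Real.rpow_nonneg (abs_nonneg a) α
  rcases le_total 0 a with h | h
  · have : 0 ≤ M ^ α * b := mul_nonneg (na.trans pa) hb
    have : 0 ≤ |a| ^ α * a := mul_nonneg na h
    linarith
  · nlinarith [mul_le_mul_of_nonneg_left hab (na.trans pa)]

end PowerNonlinearity

/-! ### Gronwall iteration and blow-up of a differential inequality -/

section Comparison

/-- A Gronwall argument by iteration, which needs no regularity of `d`. -/
theorem nonpos_of_le_mul_integral {X : Type*} {S : Set X} {d : ℝ → X → ℝ} {C L T : ℝ}
    (hC : 0 ≤ C) (hL : 0 ≤ L) (h0 : ∀ s ∈ Set.Icc 0 T, ∀ x ∈ S, d s x ≤ C)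
    (step : ∀ b : ℝ → ℝ, Continuous b → (∀ σ ∈ Set.Icc 0 T, 0 ≤ b σ) →
      (∀ σ ∈ Set.Icc 0 T, ∀ x ∈ S, d σ x ≤ b σ) →
      ∀ s ∈ Set.Icc 0 T, ∀ x ∈ S, d s x ≤ L * ∫ σ in (0 : ℝ)..s, b σ) :
    ∀ s ∈ Set.Icc 0 T, ∀ x ∈ S, d s x ≤ 0 := by
  -- Feeding the bound `C (Ls)^k / k!` back into `step` integrates it to the next one; the bounds
  -- tend to zero as `k → ∞`.
  have key : ∀ k : ℕ, ∀ s ∈ Set.Icc 0 T, ∀ x ∈ S, d s x ≤ C * ((L * s) ^ k / k.factorial) := by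
    intro k
    induction k with
    | zero => simpa using h0
    | succ k ih =>
      intro s hs x hx
      have := step (fun σ => C * ((L * σ) ^ k / k.factorial)) (by fun_prop)
        (fun σ hσ => by have := hσ.1; positivity) ih s hs x hx
      refine this.trans_eq ?_
      simp_rw [mul_pow]
      rw [intervalIntegral.integral_const_mul, intervalIntegral.integral_div,
        intervalIntegral.integral_const_mul, integral_pow, Nat.factorial_succ]
      push_cast
      field_simp
      ring
  intro s hs x hx
  have hlim := (FloorSemiring.tendsto_pow_div_factorial_atTop (L * s)).const_mul C
  rw [mul_zero] at hlim
  exact ge_of_tendsto' hlim fun k => key k s hs x hx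

/-- Blow-up time of the differential inequality `v' ≥ v^{1+α}`. -/
theorem mul_rpow_le_one_of_rpow_le {α t v₀ : ℝ} (hα : 0 < α) (ht : 0 < t) (hv₀ : 0 < v₀)
    {w : ℝ → ℝ} (hw : Integrable w) (hw0 : ∀ s, 0 ≤ w s)
    (h : ∀ s ∈ Set.Ioo 0 t, (v₀ + ∫ σ in (0 : ℝ)..s, w σ) ^ (1 + α) ≤ w s) :
    α * t * v₀ ^ α ≤ 1 := by
  set v : ℝ → ℝ := fun s => v₀ + ∫ σ in (0 : ℝ)..s, w σ with hv
  have hvc : Continuous v := continuous_const.add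
    (intervalIntegral.continuous_primitive (fun a b => hw.intervalIntegrable) 0)
  have hpc : Continuous fun s => v s ^ (1 + α) :=
    hvc.rpow_const fun _ => Or.inr (by linarith)
  have hv0 : ∀ s, 0 ≤ s → v₀ ≤ v s := fun s hs =>
    le_add_of_nonneg_right (intervalIntegral.integral_nonneg hs fun σ _ => hw0 σ)
  -- `w` is only integrable, so `v` need not be differentiable everywhere. `F` is a `C¹` minorant of
  -- `v` with `F' = v^{1+α} ≥ F^{1+α}` on `(0, t)`, so that `F^{-α} + αs` is nonincreasing.
  set F : ℝ → ℝ := fun s => v₀ + ∫ σ in (0 : ℝ)..s, v σ ^ (1 + α) with hF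
  have hFd : ∀ s, HasDerivAt F (v s ^ (1 + α)) s := fun s =>
    (hpc.integral_hasStrictDerivAt 0 s).hasDerivAt.const_add v₀
  have hF0 : ∀ s, 0 ≤ s → 0 < F s := fun s hs =>
    lt_of_lt_of_le hv₀ (le_add_of_nonneg_right (intervalIntegral.integral_nonneg hs
      fun σ hσ => Real.rpow_nonneg (hv₀.le.trans (hv0 σ hσ.1)) _))
  have hFv : ∀ s ∈ Set.Ioo 0 t, F s ≤ v s := fun s hs =>
    add_le_add_right (intervalIntegral.integral_mono_on_of_le_Ioo hs.1.le
      (hpc.intervalIntegrable 0 s) hw.intervalIntegrable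
      fun σ hσ => h σ ⟨hσ.1, hσ.2.trans hs.2⟩) v₀
  have hd : ∀ s, 0 ≤ s → HasDerivAt (fun s => F s ^ (-α) + α * s)
      (v s ^ (1 + α) * -α * F s ^ (-α - 1) + α * 1) s := fun s hs =>
    ((hFd s).rpow_const (Or.inl (hF0 s hs).ne')).add ((hasDerivAt_id s).const_mul α)
  have hanti : AntitoneOn (fun s => F s ^ (-α) + α * s) (Set.Icc 0 t) := by
    refine antitoneOn_of_deriv_nonpos (convex_Icc 0 t)
      (fun s hs => (hd s hs.1).continuousAt.continuousWithinAt)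
      (fun s hs => (hd s (interior_subset hs).1).differentiableAt.differentiableWithinAt) ?_
    intro s hs
    rw [interior_Icc] at hs
    rw [(hd s hs.1.le).deriv]
    have hFs := hF0 s hs.1.le
    have h1 : F s ^ (1 + α) ≤ v s ^ (1 + α) :=
      Real.rpow_le_rpow hFs.le (hFv s hs) (by linarith)
    have h2 : F s ^ (1 + α) * F s ^ (-α - 1) = 1 := by
      rw [← Real.rpow_add hFs, show 1 + α + (-α - 1) = 0 by ring, Real.rpow_zero]
    have h3 := mul_le_mul_of_nonneg_right h1 (Real.rpow_nonneg hFs.le (-α - 1))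
    rw [h2] at h3
    nlinarith
  have h1 := hanti (Set.left_mem_Icc.2 ht.le) (Set.right_mem_Icc.2 ht.le) ht.le
  have h2 := Real.rpow_pos_of_pos (hF0 t ht.le) (-α)
  have h3 : F 0 = v₀ := by simp [hF]
  simp only [h3, mul_zero, add_zero] at h1
  have h4 : v₀ ^ (-α) * v₀ ^ α = 1 := by
    rw [← Real.rpow_add hv₀, neg_add_cancel, Real.rpow_zero]
  have h5 := Real.rpow_pos_of_pos hv₀ α
  nlinarith

end Comparison

/-! ### Duhamel integrals -/

section Duhamel

variable {N : ℕ}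

theorem measurable_heat_sub {F : ℝ → RN N → ℝ} (hF : Measurable (Function.uncurry F)) (s : ℝ) :
    Measurable fun p : ℝ × RN N => heat (s - p.1) (F p.1) p.2 := by
  unfold heat
  refine StronglyMeasurable.measurable (StronglyMeasurable.integral_prod_right'
    (f := fun q : (ℝ × RN N) × RN N => gaussKernel (s - q.1.1) (q.1.2 - q.2) * F q.1.1 q.2) ?_)
  refine Measurable.stronglyMeasurable (Measurable.mul ?_ ?_)
  · exact measurable_gaussKernel.comp
      (f := fun q : (ℝ × RN N) × RN N => (s - q.1.1, q.1.2 - q.2)) (by fun_prop)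
  · exact hF.comp (f := fun q : (ℝ × RN N) × RN N => (q.1.1, q.2)) (by fun_prop)

theorem measurable_heat_sub_left {F : ℝ → RN N → ℝ} (hF : Measurable (Function.uncurry F)) (s : ℝ)
    (x : RN N) : Measurable fun σ => heat (s - σ) (F σ) x :=
  (measurable_heat_sub hF s).comp (f := fun σ : ℝ => (σ, x)) (by fun_prop)

theorem integrableOn_heat_sub {F : ℝ → RN N → ℝ} (hF : Measurable (Function.uncurry F)) {B : ℝ}
    (hB : ∀ σ y, |F σ y| ≤ B) (t : ℝ) (x : RN N) :
    IntegrableOn (fun σ => heat (t - σ) (F σ) x) (Set.Ioo 0 t) := by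
  refine Measure.integrableOn_of_bounded (M := B) (by simp)
    (measurable_heat_sub_left hF t x).aestronglyMeasurable
    ((ae_restrict_iff' measurableSet_Ioo).2 (ae_of_all _ fun σ hσ => ?_))
  exact abs_heat_le (sub_pos.2 hσ.2) x (hB σ)

theorem intervalIntegrable_heat_sub {F : ℝ → RN N → ℝ} (hF : Measurable (Function.uncurry F))
    {B : ℝ} (hB : ∀ σ y, |F σ y| ≤ B) {s t : ℝ} (hs : 0 ≤ s) (hst : s ≤ t) (x : RN N) :
    IntervalIntegrable (fun σ => heat (t - σ) (F σ) x) volume 0 s := by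
  rw [intervalIntegrable_iff_integrableOn_Ioo_of_le hs]
  exact (integrableOn_heat_sub hF hB t x).mono_set (Set.Ioo_subset_Ioo_right hst)

/-- Fubini and the semigroup law under the time integral. Passing to the open interval `(0, s)`
keeps `s - σ` positive, which the semigroup law needs. -/
theorem heat_integral_heat {F : ℝ → RN N → ℝ} (hF : Measurable (Function.uncurry F))
    {B : ℝ} (hB : ∀ σ y, |F σ y| ≤ B) {s t : ℝ} (hs : 0 < s) (hst : s < t) (x : RN N) :
    heat (t - s) (fun y => ∫ σ in (0 : ℝ)..s, heat (s - σ) (F σ) y) x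
      = ∫ σ in (0 : ℝ)..s, heat (t - σ) (F σ) x := by
  have hts := sub_pos.2 hst
  simp_rw [intervalIntegral.integral_of_le hs.le, integral_Ioc_eq_integral_Ioo]
  rw [heat]
  simp_rw [← integral_const_mul]
  rw [integral_integral_swap]
  · refine setIntegral_congr_fun measurableSet_Ioo fun σ hσ => ?_
    have hFσ : Measurable (F σ) := hF.comp (measurable_const.prodMk measurable_id)
    have := heat_comp hts (sub_pos.2 hσ.2) hFσ (hB σ) x
    rw [sub_add_sub_cancel] at this
    exact this
  · have hint : Integrable (fun p : RN N × ℝ => gaussKernel (t - s) (x - p.1) * B)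
        (volume.prod (volume.restrict (Set.Ioo 0 s))) :=
      (integrable_gaussKernel_sub hts x).mul_prod (integrable_const B)
    refine hint.mono' (Measurable.aestronglyMeasurable ?_) ?_
    · exact ((measurable_gaussKernel_sub (t - s) x).comp measurable_fst).mul
        ((measurable_heat_sub hF s).comp measurable_swap)
    · have h1 : ∀ᵐ σ ∂(volume.restrict (Set.Ioo 0 s)), σ < s :=
        (ae_restrict_iff' measurableSet_Ioo).2 (ae_of_all _ fun σ hσ => hσ.2)
      filter_upwards [Measure.quasiMeasurePreserving_snd.ae h1] with p hp
      simp only [Function.uncurry]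
      rw [norm_mul, Real.norm_of_nonneg (gaussKernel_pos hts _).le]
      exact mul_le_mul_of_nonneg_left (abs_heat_le (sub_pos.2 hp) p.1 (hB _))
        (gaussKernel_pos hts _).le

end Duhamel

/-! ### Mild solutions: symmetry, positivity, and the necessary condition for existence -/

section MildSolution

variable {N : ℕ}

theorem heat_add {t : ℝ} (ht : 0 < t) (x : RN N) {φ ψ : RN N → ℝ} (hφ : Measurable φ)
    (hψ : Measurable ψ) {A B : ℝ} (hA : ∀ y, |φ y| ≤ A) (hB : ∀ y, |ψ y| ≤ B) :
    heat t φ x + heat t ψ x = heat t (fun y => φ y + ψ y) x := by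
  unfold heat
  rw [← integral_add (integrable_gaussKernel_mul ht x hφ.aestronglyMeasurable hA)
    (integrable_gaussKernel_mul ht x hψ.aestronglyMeasurable hB)]
  simp only [mul_add]

/-- A bounded continuous solution on `[0, T]` of the integral equation. -/
structure IsMildSolution (α M T : ℝ) (U : ℝ → RN N → ℝ) : Prop where
  continuous : Continuous (Function.uncurry U)
  bound : ∀ σ y, |U σ y| ≤ M
  eq : ∀ s, 0 < s → s ≤ T → ∀ x, U s x = heat s (U 0) x
    + ∫ σ in (0 : ℝ)..s, heat (s - σ) (fun y => |U σ y| ^ α * U σ y) x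

namespace IsMildSolution

variable {α M T : ℝ} {U : ℝ → RN N → ℝ}

theorem nonneg_bound (hU : IsMildSolution α M T U) : 0 ≤ M := (abs_nonneg _).trans (hU.bound 0 0)

theorem continuous_apply (hU : IsMildSolution α M T U) (σ : ℝ) : Continuous (U σ) :=
  hU.continuous.comp (Continuous.prodMk_right σ)

theorem measurable_source (hU : IsMildSolution α M T U) :
    Measurable (Function.uncurry fun σ y => |U σ y| ^ α * U σ y) := by
  have := hU.continuous.measurable
  exact (this.abs.pow_const α).mul this

theorem measurable_source_apply (hU : IsMildSolution α M T U) (σ : ℝ) :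
    Measurable fun y => |U σ y| ^ α * U σ y :=
  hU.measurable_source.comp (measurable_const.prodMk measurable_id)

theorem source_bound (hα : 0 < α) (hU : IsMildSolution α M T U) (σ : ℝ) (y : RN N) :
    |(|U σ y| ^ α * U σ y)| ≤ M ^ α * M :=
  abs_abs_rpow_mul_self_le hα (hU.bound σ y)

/-- The solution inherits the anti-symmetry of its initial value. -/
theorem antiSymm (hα : 0 < α) (hU : IsMildSolution α M T U) {i : Fin N}
    (h0 : ∀ x, U 0 (reflect {i} x) = -U 0 x) {s : ℝ} (hs : s ∈ Set.Icc 0 T) (x : RN N) :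
    U s (reflect {i} x) = -U s x := by
  have hM := hU.nonneg_bound
  have hMα : 0 ≤ M ^ α := Real.rpow_nonneg hM α
  -- The defect `|U(x) + U(R_i x)|` vanishes at time zero. The nonlinearity is odd and Lipschitz on
  -- `[-M, M]`, so the defect satisfies a linear integral inequality.
  have key := nonpos_of_le_mul_integral (S := Set.univ) (C := 2 * M) (L := (1 + α) * M ^ α)
    (T := T) (d := fun s x => |U s x + U s (reflect {i} x)|) (by positivity) (by positivity)
    (fun s _ x _ => (abs_add_le _ _).trans
      (by linarith [hU.bound s x, hU.bound s (reflect {i} x)])) ?_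
  · have := key s hs x trivial
    have := abs_nonpos_iff.1 this
    linarith
  intro b hbc hb0 hb s hs x _
  rcases hs.1.eq_or_lt with rfl | hs0
  · simp [h0]
  have hsF := hU.source_bound hα
  have hm := hU.measurable_source_apply
  have hr := (continuous_reflect ({i} : Finset (Fin N))).measurable
  have hU0 := (hU.continuous_apply 0).measurable
  rw [hU.eq s hs0 hs.2 x, hU.eq s hs0 hs.2 (reflect {i} x)]
  simp only [heat_reflect]
  rw [add_add_add_comm, heat_add hs0 x hU0 (ψ := fun y => U 0 (reflect {i} y)) (hU0.comp hr) (hU.bound 0)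
      (fun y => hU.bound 0 _),
    ← intervalIntegral.integral_add
      (intervalIntegrable_heat_sub hU.measurable_source hsF hs0.le le_rfl x)
      (intervalIntegrable_heat_sub (F := fun σ y => |U σ (reflect {i} y)| ^ α * U σ (reflect {i} y))
        (hU.measurable_source.comp (f := fun p : ℝ × RN N => (p.1, reflect {i} p.2))
          (measurable_fst.prodMk (hr.comp measurable_snd))) (fun σ y => hsF σ _) hs0.le le_rfl x)]
  have e0 : heat s (fun y => U 0 y + U 0 (reflect {i} y)) x = 0 := by simp [heat, h0]
  rw [e0, zero_add, ← intervalIntegral.integral_const_mul, ← Real.norm_eq_abs]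
  refine intervalIntegral.norm_integral_le_integral_norm hs0.le |>.trans ?_
  refine intervalIntegral.integral_mono_on_of_le_Ioo hs0.le ?_
    ((hbc.const_mul _).intervalIntegrable _ _) fun σ hσ => ?_
  · exact ((intervalIntegrable_heat_sub hU.measurable_source hsF hs0.le le_rfl x).add
      (intervalIntegrable_heat_sub (F := fun σ y => |U σ (reflect {i} y)| ^ α * U σ (reflect {i} y))
        (hU.measurable_source.comp (f := fun p : ℝ × RN N => (p.1, reflect {i} p.2))
          (measurable_fst.prodMk (hr.comp measurable_snd)))
          (fun σ y => hsF σ _) hs0.le le_rfl x)).norm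
  · rw [heat_add (sub_pos.2 hσ.2) x (hm σ)
      (ψ := fun y => |U σ (reflect {i} y)| ^ α * U σ (reflect {i} y)) ((hm σ).comp hr) (hsF σ)
      (fun y => hsF σ _)]
    refine abs_heat_le (sub_pos.2 hσ.2) x fun y => ?_
    have h1 := abs_rpow_mul_self_sub_le hα (hU.bound σ y)
      (by simpa using hU.bound σ (reflect {i} y) : |-U σ (reflect {i} y)| ≤ M)
    rw [abs_neg, mul_neg, sub_neg_eq_add, sub_neg_eq_add] at h1
    exact h1.trans (mul_le_mul_of_nonneg_left (hb σ ⟨hσ.1.le, hσ.2.le.trans hs.2⟩ y trivial)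
      (by positivity))

variable {J : Finset (Fin N)}

theorem source_antiSymm (hα : 0 < α) (hU : IsMildSolution α M T U)
    (h0 : ∀ i ∈ J, ∀ x, U 0 (reflect {i} x) = -U 0 x) {s : ℝ} (hs : s ∈ Set.Icc 0 T) :
    ∀ i ∈ J, ∀ x, |U s (reflect {i} x)| ^ α * U s (reflect {i} x) = -(|U s x| ^ α * U s x) := by
  intro i hi x
  rw [hU.antiSymm hα (h0 i hi) hs x, abs_neg, mul_neg]

/-- The solution stays nonnegative on the orthant. -/
theorem nonneg (hα : 0 < α) (hU : IsMildSolution α M T U)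
    (h0 : ∀ i ∈ J, ∀ x, U 0 (reflect {i} x) = -U 0 x) (hpos : ∀ x ∈ orthant J, 0 ≤ U 0 x)
    {s : ℝ} (hs : s ∈ Set.Icc 0 T) {x : RN N} (hx : x ∈ orthant J) : 0 ≤ U s x := by
  have hM := hU.nonneg_bound
  have hMα : 0 ≤ M ^ α := Real.rpow_nonneg hM α
  have key := nonpos_of_le_mul_integral (S := orthant J) (C := M) (L := M ^ α)
    (T := T) (d := fun s x => -U s x) hM hMα
    (fun s _ x _ => (neg_le_abs _).trans (hU.bound s x)) ?_
  · have := key s hs x hx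
    linarith
  intro b hbc hb0 hb s hs x hx
  rcases hs.1.eq_or_lt with rfl | hs0
  · simpa using hpos x hx
  have hsF := hU.source_bound hα
  have h1 : 0 ≤ heat s (U 0) x := by
    rw [heat_eq_setIntegral_orthant hs0 h0
      (hU.continuous_apply 0).aestronglyMeasurable (hU.bound 0)]
    exact setIntegral_nonneg (measurableSet_orthant J) fun y hy =>
      mul_nonneg (orthantKernel_pos hs0 hx hy).le (hpos y hy)
  have h2 : ∫ σ in (0 : ℝ)..s, -(M ^ α * b σ)
      ≤ ∫ σ in (0 : ℝ)..s, heat (s - σ) (fun y => |U σ y| ^ α * U σ y) x := by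
    refine intervalIntegral.integral_mono_on_of_le_Ioo hs0.le
      ((hbc.const_mul _).neg.intervalIntegrable _ _)
      (intervalIntegrable_heat_sub hU.measurable_source hsF hs0.le le_rfl x) fun σ hσ => ?_
    have hσT : σ ∈ Set.Icc 0 T := ⟨hσ.1.le, hσ.2.le.trans hs.2⟩
    have hsσ := sub_pos.2 hσ.2
    rw [heat_eq_setIntegral_orthant hsσ (hU.source_antiSymm hα h0 hσT)
      (hU.measurable_source_apply σ).aestronglyMeasurable (hsF σ)]
    have h3 : ∫ y in orthant J, orthantKernel J (s - σ) x y * -(M ^ α * b σ)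
        ≤ ∫ y in orthant J, orthantKernel J (s - σ) x y * (|U σ y| ^ α * U σ y) := by
      refine setIntegral_mono_on ((integrableOn_orthantKernel J hsσ hx).mul_const _)
        (integrableOn_orthantKernel_mul hsσ hx
          (hU.measurable_source_apply σ).aestronglyMeasurable (hsF σ))
        (measurableSet_orthant J) fun y hy => ?_
      exact mul_le_mul_of_nonneg_left (neg_mul_le_abs_rpow_mul_self hα (hU.bound σ y) (hb0 σ hσT)
        (hb σ hσT y hy)) (orthantKernel_pos hsσ hx hy).le
    refine le_trans ?_ h3
    rw [integral_mul_const]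
    have h4 := setIntegral_orthantKernel_le_one J hsσ hx
    have h5 : 0 ≤ M ^ α * b σ := mul_nonneg hMα (hb0 σ hσT)
    nlinarith
  rw [intervalIntegral.integral_neg, intervalIntegral.integral_const_mul] at h2
  rw [hU.eq s hs0 hs.2 x]
  linarith

end IsMildSolution

/-- Jensen's inequality for the sub-Markovian heat kernel of an orthant. -/
theorem rpow_heat_le_heat_rpow {J : Finset (Fin N)} {α t M : ℝ} (hα : 0 < α) (ht : 0 < t)
    {g : RN N → ℝ} (hg : ∀ i ∈ J, ∀ x, g (reflect {i} x) = -g x) (hgm : Measurable g)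
    (hM : ∀ y, |g y| ≤ M) (hpos : ∀ y ∈ orthant J, 0 ≤ g y) {x : RN N} (hx : x ∈ orthant J) :
    0 ≤ heat t g x ∧ heat t g x ^ (1 + α) ≤ heat t (fun y => |g y| ^ α * g y) x := by
  have hgs : ∀ i ∈ J, ∀ x, |g (reflect {i} x)| ^ α * g (reflect {i} x) = -(|g x| ^ α * g x) := by
    intro i hi x
    rw [hg i hi x, abs_neg, mul_neg]
  have hnm : Measurable fun y => |g y| ^ α * g y := (hgm.abs.pow_const α).mul hgm
  have hnb : ∀ y, |(|g y| ^ α * g y)| ≤ M ^ α * M := fun y => abs_abs_rpow_mul_self_le hα (hM y)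
  rw [heat_eq_setIntegral_orthant ht hg hgm.aestronglyMeasurable hM,
    heat_eq_setIntegral_orthant ht hgs hnm.aestronglyMeasurable hnb]
  set a := ∫ y in orthant J, orthantKernel J t x y * g y with ha
  have ha0 : 0 ≤ a := setIntegral_nonneg (measurableSet_orthant J) fun y hy =>
    mul_nonneg (orthantKernel_pos ht hx hy).le (hpos y hy)
  refine ⟨ha0, ?_⟩
  have hi1 := integrableOn_orthantKernel J ht hx
  have hi2 := integrableOn_orthantKernel_mul ht hx hgm.aestronglyMeasurable hM
  -- Integrate the tangent inequality at the mean `a` against the kernel. The constant term is `-α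
  -- a^{1+α} ≤ 0`, so total mass at most one is enough.
  have hi3 : IntegrableOn (fun y => orthantKernel J t x y * (a ^ α * a - (1 + α) * a ^ α * a)
      + (orthantKernel J t x y * g y) * ((1 + α) * a ^ α)) (orthant J) :=
    (hi1.mul_const _).add (hi2.mul_const _)
  have h1 := setIntegral_mono_on hi3
    (integrableOn_orthantKernel_mul ht hx hnm.aestronglyMeasurable hnb)
    (measurableSet_orthant J) fun y hy => by
      have h2 := rpow_one_add_ge_tangent hα ha0 (hpos y hy)
      have h3 := mul_le_mul_of_nonneg_left h2 (orthantKernel_pos ht hx hy).le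
      rw [abs_of_nonneg (hpos y hy)]
      linarith
  rw [integral_add (hi1.mul_const _) (hi2.mul_const _), integral_mul_const, integral_mul_const,
    ← ha] at h1
  refine le_trans ?_ h1
  rw [add_comm 1 α, Real.rpow_add_one' ha0 (by positivity)]
  have h4 := setIntegral_orthantKernel_le_one J ht hx
  have h5 : 0 ≤ a ^ α * a := mul_nonneg (Real.rpow_nonneg ha0 α) ha0
  nlinarith [mul_nonneg (mul_nonneg hα.le h5) (sub_nonneg.2 h4)]

/-- The necessary condition on the initial value for existence up to time `t`. -/
theorem IsMildSolution.mul_rpow_heat_le_one {J : Finset (Fin N)} {α M t : ℝ} {U : ℝ → RN N → ℝ}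
    (hα : 0 < α) (ht : 0 < t) (hU : IsMildSolution α M t U)
    (h0 : ∀ i ∈ J, ∀ x, U 0 (reflect {i} x) = -U 0 x) (hpos : ∀ x ∈ orthant J, 0 ≤ U 0 x)
    {x : RN N} (hx : x ∈ orthant J) : α * t * heat t (U 0) x ^ α ≤ 1 := by
  have hsF := hU.source_bound hα
  have hJ : ∀ s ∈ Set.Ico 0 t, 0 ≤ heat (t - s) (U s) x ∧
      heat (t - s) (U s) x ^ (1 + α) ≤ heat (t - s) (fun y => |U s y| ^ α * U s y) x :=
    fun s hs => rpow_heat_le_heat_rpow hα (sub_pos.2 hs.2)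
      (fun i hi => hU.antiSymm hα (h0 i hi) ⟨hs.1, hs.2.le⟩)
      (hU.continuous_apply s).measurable (hU.bound s)
      (fun y hy => hU.nonneg hα h0 hpos ⟨hs.1, hs.2.le⟩ hy) hx
  have hv0 : 0 ≤ heat t (U 0) x := by simpa using (hJ 0 ⟨le_rfl, ht⟩).1
  rcases hv0.eq_or_lt with hz | hv0
  · rw [← hz, Real.zero_rpow hα.ne']
    simp
  -- The integrand is cut off to `(0, t)`, where `t - σ > 0` and its integrability and sign are
  -- known.
  set w : ℝ → ℝ := (Set.Ioo 0 t).indicator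
    fun σ => heat (t - σ) (fun y => |U σ y| ^ α * U σ y) x with hw
  have hwi : Integrable w := (integrable_indicator_iff measurableSet_Ioo).2
    (integrableOn_heat_sub hU.measurable_source hsF t x)
  refine mul_rpow_le_one_of_rpow_le hα ht hv0 hwi ?_ ?_
  · intro s
    refine Set.indicator_nonneg (fun σ hσ => ?_) s
    have := hJ σ ⟨hσ.1.le, hσ.2⟩
    exact (Real.rpow_nonneg this.1 _).trans this.2
  · intro s hs
    have h1 : ∫ σ in (0 : ℝ)..s, w σ
        = ∫ σ in (0 : ℝ)..s, heat (t - σ) (fun y => |U σ y| ^ α * U σ y) x := by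
      rw [intervalIntegral.integral_of_le hs.1.le, intervalIntegral.integral_of_le hs.1.le]
      refine setIntegral_congr_fun measurableSet_Ioc fun σ hσ => ?_
      exact Set.indicator_of_mem (show σ ∈ Set.Ioo 0 t from ⟨hσ.1, hσ.2.trans_lt hs.2⟩) _
    have hts := sub_pos.2 hs.2
    -- Applying `e^{(t-s)Δ}` to the integral equation at time `s` identifies `v(s)` as `v(0) + ∫₀ˢ
    -- w`.
    have h2 : heat (t - s) (U s) x = heat t (U 0) x + ∫ σ in (0 : ℝ)..s, w σ := by
      have hm1 : Measurable (heat s (U 0)) := by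
        have := (measurable_heat_sub (F := fun _ => U 0)
          ((hU.continuous_apply 0).measurable.comp measurable_snd) s).comp
          (f := fun y : RN N => ((0 : ℝ), y)) (by fun_prop)
        simpa [Function.comp_def] using this
      have hb1 : ∀ y, |heat s (U 0) y| ≤ M := fun y => abs_heat_le hs.1 y (hU.bound 0)
      have h4 : (fun y => ∫ σ in (0 : ℝ)..s, heat (s - σ) (fun y => |U σ y| ^ α * U σ y) y)
          = fun y => U s y - heat s (U 0) y := by
        funext y
        rw [hU.eq s hs.1 hs.2.le y]
        ring
      rw [h1, ← heat_integral_heat hU.measurable_source hsF hs.1 hs.2 x]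
      have h5 := heat_comp hts hs.1 (hU.continuous_apply 0).measurable (hU.bound 0) x
      rw [sub_add_cancel] at h5
      rw [← h5, h4, heat_add hts x hm1
        (ψ := fun y => U s y - heat s (U 0) y) ((hU.continuous_apply s).measurable.sub hm1) hb1
        (fun y => (abs_sub _ _).trans (add_le_add (hU.bound s y) (hb1 y)))]
      simp
    rw [← h2]
    have := (hJ s ⟨hs.1.le, hs.2⟩).2
    rwa [hw, Set.indicator_of_mem hs]

/-- A solution on `[0, T)` satisfies the necessary condition at every time `t < T`. -/
theorem IsSolution.mul_rpow_heat_le_one {m : ℕ} {α t : ℝ} (hα : 0 < α) (ht : 0 < t)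
    {u₀ : C₀(RN N, ℝ)} {T : ℝ≥0∞} {u : ℝ → C₀(RN N, ℝ)} (hu : IsSolution 1 α u₀ T u)
    (htT : ENNReal.ofReal t < T) (h0 : AntiSymm m u₀) (hpos : ∀ x ∈ sector N m, 0 ≤ u₀ x)
    {x : RN N} (hx : x ∈ sector N m) : α * t * heat t u₀ x ^ α ≤ 1 := by
  obtain ⟨hu0, huc, hueq⟩ := hu
  have hlt : ∀ s ≤ t, ENNReal.ofReal s < T := fun s hs =>
    (ENNReal.ofReal_le_ofReal hs).trans_lt htT
  -- Clamping time to `[0, t]` makes the solution continuous and bounded for all real times, as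
  -- `IsMildSolution` asks, without changing it on `[0, t]`.
  have hproj : Continuous fun σ => u (Set.projIcc 0 t ht.le σ) := by
    refine huc.comp_continuous (continuous_subtype_val.comp continuous_projIcc) fun σ => ?_
    exact ⟨(Set.projIcc 0 t ht.le σ).2.1, hlt _ (Set.projIcc 0 t ht.le σ).2.2⟩
  have heq : ∀ σ ∈ Set.Icc 0 t, u (Set.projIcc 0 t ht.le σ) = u σ := fun σ hσ => by
    rw [Set.projIcc_of_mem ht.le hσ]
  obtain ⟨M, hM⟩ : ∃ M, ∀ σ ∈ Set.Icc 0 t, ‖u σ‖ ≤ M :=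
    isCompact_Icc.exists_bound_of_continuousOn
      (huc.mono fun σ hσ => ⟨hσ.1, hlt σ hσ.2⟩)
  have hbcf : Continuous fun σ => (u (Set.projIcc 0 t ht.le σ)).toBCF :=
    ZeroAtInftyContinuousMap.isometry_toBCF.continuous.comp hproj
  have hU : IsMildSolution α M t fun σ y => u (Set.projIcc 0 t ht.le σ) y := by
    refine ⟨?_, ?_, ?_⟩
    · exact (hbcf.comp continuous_fst).eval continuous_snd
    · intro σ y
      refine le_trans ?_ (hM _ (Set.projIcc 0 t ht.le σ).2)
      exact (u (Set.projIcc 0 t ht.le σ)).toBCF.norm_coe_le_norm y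
    · intro s hs hst x
      rw [heq s ⟨hs.le, hst⟩, heq 0 ⟨le_rfl, ht.le⟩, hu0, hueq s hs (hlt s hst) x, one_mul]
      congr 1
      refine intervalIntegral.integral_congr fun σ hσ => ?_
      rw [Set.uIcc_of_le hs.le] at hσ
      simp only [heq σ ⟨hσ.1, hσ.2.trans hst⟩]
  have h00 : u (Set.projIcc 0 t ht.le 0) = u₀ := by rw [heq 0 ⟨le_rfl, ht.le⟩, hu0]
  have := hU.mul_rpow_heat_le_one (J := firstIdx N m) hα ht (by rw [h00]; exact h0)
    (by rw [h00]; exact hpos) hx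
  rwa [h00] at this

end MildSolution

/-! ### Distributional positivity implies positivity almost everywhere -/

section Nonneg

variable {E : Type*} [NormedAddCommGroup E] [NormedSpace ℝ E] [FiniteDimensional ℝ E]
  [MeasurableSpace E] [BorelSpace E] {μ : Measure E} [μ.IsAddHaarMeasure]

/-- A locally integrable function that is nonnegative as a distribution on an open set is
nonnegative almost everywhere there. -/
theorem ae_nonneg_of_integral_contDiff_mul_nonneg {U : Set E} (hU : IsOpen U) {h : E → ℝ}
    (hh : LocallyIntegrableOn h U μ)
    (hpos : ∀ φ : E → ℝ, ContDiff ℝ ((⊤ : ℕ∞) : WithTop ℕ∞) φ → HasCompactSupport φ →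
      tsupport φ ⊆ U → (∀ x, 0 ≤ φ x) → 0 ≤ ∫ x, φ x * h x ∂μ) :
    ∀ᵐ x ∂μ, x ∈ U → 0 ≤ h x := by
  rw [ae_iff]
  refine measure_null_of_locally_null _ fun x₀ hx₀ => ?_
  have hx₀U : x₀ ∈ U := by by_contra hc; exact hx₀ fun h => absurd h hc
  obtain ⟨r, hr, hrU⟩ := Metric.isOpen_iff.1 hU x₀ hx₀U
  have hr4 : 0 < r / 4 := by positivity
  have hBU : Metric.closedBall x₀ (2 * (r / 4)) ⊆ U :=
    (Metric.closedBall_subset_ball (by linarith)).trans hrU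
  have hB : IntegrableOn h (Metric.closedBall x₀ (2 * (r / 4))) μ :=
    hh.integrableOn_compact_subset hBU (isCompact_closedBall _ _)
  -- Truncation gives a globally integrable function. Bumps of radius at most `r / 4` around points
  -- of the ball of radius `r / 4` see only the ball of radius `r / 2`, where `h₁ = h`.
  set h₁ := (Metric.closedBall x₀ (2 * (r / 4))).indicator h with hh₁
  have h₁i : Integrable h₁ μ := (integrable_indicator_iff measurableSet_closedBall).2 hB
  let φ : ℕ → ContDiffBump (0 : E) := fun n =>
    ⟨r / 4 / (2 * (n + 1)), r / 4 / (n + 1), by positivity, by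
      rw [div_lt_div_iff_of_pos_left hr4 (by positivity) (by positivity)]
      have : (0 : ℝ) ≤ n := n.cast_nonneg
      linarith⟩
  have hφ : Tendsto (fun n => (φ n).rOut) atTop (𝓝 0) := by
    have := (tendsto_one_div_add_atTop_nhds_zero_nat (𝕜 := ℝ)).const_mul (r / 4)
    simpa [φ, div_eq_mul_inv] using this
  have hconv := ContDiffBump.ae_convolution_tendsto_right_of_locallyIntegrable (μ := μ)
    (φ := φ) (l := atTop) (K := 2) hφ (Eventually.of_forall fun n => by
      simp only [φ]
      refine le_of_eq ?_
      field_simp) h₁i.locallyIntegrable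
  refine ⟨Metric.ball x₀ (r / 4) ∩ {x | ¬(x ∈ U → 0 ≤ h x)},
    inter_mem (mem_nhdsWithin_of_mem_nhds (Metric.ball_mem_nhds x₀ hr4)) self_mem_nhdsWithin, ?_⟩
  refine measure_mono_null ?_ (ae_iff.1 hconv)
  rintro x ⟨hxb, hx⟩ hlim
  refine hx fun _ => ?_
  have hxB : x ∈ Metric.closedBall x₀ (2 * (r / 4)) := by
    rw [Metric.mem_closedBall]
    have := Metric.mem_ball.1 hxb
    linarith
  have e : h₁ x = h x := Set.indicator_of_mem hxB _
  rw [← e]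
  refine ge_of_tendsto' hlim fun n => ?_
  have hsupp : ∀ y, (φ n).normed μ (x - y) ≠ 0 → y ∈ Metric.closedBall x₀ (2 * (r / 4)) := by
    intro y hy
    have h1 : x - y ∈ Function.support ((φ n).normed μ) := hy
    rw [ContDiffBump.support_normed_eq, mem_ball_zero_iff] at h1
    have h2 : (φ n).rOut ≤ r / 4 := div_le_self hr4.le (by
      have : (0 : ℝ) ≤ n := n.cast_nonneg
      linarith)
    rw [Metric.mem_closedBall]
    have h3 := dist_triangle y x x₀
    have h4 := Metric.mem_ball.1 hxb
    rw [dist_comm y x, dist_eq_norm x y] at h3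
    linarith
  have e2 : MeasureTheory.convolution ((φ n).normed μ) h₁ (ContinuousLinearMap.lsmul ℝ ℝ) μ x
      = ∫ y, (φ n).normed μ (x - y) * h y ∂μ := by
    rw [convolution_eq_swap]
    refine integral_congr_ae (ae_of_all _ fun y => ?_)
    simp only [ContinuousLinearMap.lsmul_apply, smul_eq_mul]
    by_cases hy : (φ n).normed μ (x - y) = 0
    · rw [hy, zero_mul, zero_mul]
    · rw [hh₁, Set.indicator_of_mem (hsupp y hy)]
  rw [e2]
  have htsupp : tsupport (fun y => (φ n).normed μ (x - y))
      ⊆ Metric.closedBall x₀ (2 * (r / 4)) :=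
    closure_minimal (fun y hy => hsupp y hy) Metric.isClosed_closedBall
  refine hpos _ ?_ ?_ (htsupp.trans hBU) fun y => ContDiffBump.nonneg_normed _ _
  · exact (ContDiffBump.contDiff_normed _).comp (contDiff_const.sub contDiff_id)
  · exact (isCompact_closedBall x₀ (2 * (r / 4))).of_isClosed_subset (isClosed_tsupport _) htsupp

end Nonneg

/-! ### Smooth cutoffs inside an orthant -/

section Cutoff

variable {N : ℕ}

/-- Smooth compactly supported functions in an orthant that tend to `1`. -/
noncomputable def orthantCutoff (J : Finset (Fin N)) (k : ℕ) (y : RN N) : ℝ :=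
  Real.smoothTransition (2 - ‖y‖ ^ 2 / (k + 1) ^ 2)
    * ∏ i ∈ J, Real.smoothTransition ((k + 1) * y i - 1)

theorem contDiff_orthantCutoff (J : Finset (Fin N)) (k : ℕ) :
    ContDiff ℝ ((⊤ : ℕ∞) : WithTop ℕ∞) (orthantCutoff J k) := by
  have : ContDiff ℝ ((⊤ : ℕ∞) : WithTop ℕ∞) fun y : RN N => ‖y‖ ^ 2 := contDiff_norm_sq ℝ
  unfold orthantCutoff
  refine (Real.smoothTransition.contDiff.comp (contDiff_const.sub (this.div_const _))).mul
    (contDiff_prod fun i _ => Real.smoothTransition.contDiff.comp ?_)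
  fun_prop

theorem orthantCutoff_nonneg (J : Finset (Fin N)) (k : ℕ) (y : RN N) : 0 ≤ orthantCutoff J k y :=
  mul_nonneg (Real.smoothTransition.nonneg _)
    (Finset.prod_nonneg fun _ _ => Real.smoothTransition.nonneg _)

theorem orthantCutoff_le_one (J : Finset (Fin N)) (k : ℕ) (y : RN N) : orthantCutoff J k y ≤ 1 :=
  mul_le_one₀ (Real.smoothTransition.le_one _)
    (Finset.prod_nonneg fun _ _ => Real.smoothTransition.nonneg _)
    (Finset.prod_le_one (fun _ _ => Real.smoothTransition.nonneg _)
      fun _ _ => Real.smoothTransition.le_one _)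

/-- The radial factor vanishes once `‖y‖² ≥ 2(k+1)²`, and each coordinate factor once `y i ≤
1/(k+1)`. The support is thus bounded and stays away from the walls. -/
theorem tsupport_orthantCutoff_subset (J : Finset (Fin N)) (k : ℕ) :
    tsupport (orthantCutoff J k)
      ⊆ Metric.closedBall 0 (2 * (k + 1)) ∩ {y | ∀ i ∈ J, 1 / ((k : ℝ) + 1) ≤ y i} := by
  have hk : (0 : ℝ) < k + 1 := by positivity
  refine closure_minimal (fun y hy => ?_) (Metric.isClosed_closedBall.inter ?_)
  · have h1 := left_ne_zero_of_mul hy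
    have h2 := right_ne_zero_of_mul hy
    refine ⟨?_, fun i hi => ?_⟩
    · have h3 : 0 < 2 - ‖y‖ ^ 2 / ((k : ℝ) + 1) ^ 2 := by
        by_contra hc
        exact h1 (Real.smoothTransition.zero_of_nonpos (not_lt.1 hc))
      have h4 := (div_lt_iff₀ (by positivity)).1 (sub_pos.1 h3)
      rw [mem_closedBall_zero_iff]
      refine abs_le_of_sq_le_sq' ?_ (by positivity) |>.2
      nlinarith
    · have h3 : 0 < ((k : ℝ) + 1) * y i - 1 := by
        by_contra hc
        exact Finset.prod_ne_zero_iff.1 h2 i hi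
          (Real.smoothTransition.zero_of_nonpos (not_lt.1 hc))
      rw [div_le_iff₀' hk]
      linarith
  · have : {y : RN N | ∀ i ∈ J, 1 / ((k : ℝ) + 1) ≤ y i}
        = ⋂ i ∈ J, {y : RN N | 1 / ((k : ℝ) + 1) ≤ y i} := by ext y; simp
    rw [this]
    exact isClosed_biInter fun i _ => isClosed_le continuous_const (by fun_prop)

theorem hasCompactSupport_orthantCutoff (J : Finset (Fin N)) (k : ℕ) :
    HasCompactSupport (orthantCutoff J k) :=
  (isCompact_closedBall (0 : RN N) _).of_isClosed_subset (isClosed_tsupport _)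
    ((tsupport_orthantCutoff_subset J k).trans Set.inter_subset_left)

theorem tsupport_orthantCutoff_subset_orthant (J : Finset (Fin N)) (k : ℕ) :
    tsupport (orthantCutoff J k) ⊆ orthant J := fun y hy i hi =>
  lt_of_lt_of_le (by positivity) ((tsupport_orthantCutoff_subset J k hy).2 i hi)

theorem tendsto_orthantCutoff {J : Finset (Fin N)} {y : RN N} (hy : y ∈ orthant J) :
    Tendsto (fun k => orthantCutoff J k y) atTop (𝓝 1) := by
  have hk : Tendsto (fun k : ℕ => (k : ℝ) + 1) atTop atTop :=
    tendsto_atTop_add_const_right _ _ tendsto_natCast_atTop_atTop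
  have h1 : Tendsto (fun k : ℕ => Real.smoothTransition (2 - ‖y‖ ^ 2 / ((k : ℝ) + 1) ^ 2)) atTop
      (𝓝 1) := by
    have h2 : Tendsto (fun k : ℕ => 2 - ‖y‖ ^ 2 / ((k : ℝ) + 1) ^ 2) atTop (𝓝 (2 - 0)) :=
      tendsto_const_nhds.sub (((tendsto_pow_atTop two_ne_zero).comp hk).const_div_atTop _)
    have h3 := (Real.smoothTransition.continuous.tendsto _).comp h2
    rwa [Real.smoothTransition.one_of_one_le (by norm_num)] at h3
  have h2 : Tendsto (fun k : ℕ => ∏ i ∈ J, Real.smoothTransition (((k : ℝ) + 1) * y i - 1)) atTop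
      (𝓝 (∏ i ∈ J, 1)) := by
    refine tendsto_finsetProd _ fun i hi => ?_
    have h3 : Tendsto (fun k : ℕ => ((k : ℝ) + 1) * y i - 1) atTop atTop :=
      tendsto_atTop_add_const_right _ _ (hk.atTop_mul_const (hy i hi))
    refine tendsto_const_nhds.congr' ?_
    filter_upwards [h3.eventually_ge_atTop 1] with k hk1
    exact (Real.smoothTransition.one_of_one_le hk1).symm
  simpa [orthantCutoff] using h1.mul h2

end Cutoff

/-! ### The homogeneous majorant and passage to the limit -/

section Profile

variable {N : ℕ}

/-- Inside the unit ball the Gaussian is bounded and polar coordinates leave `r^{N-1-γ}`, integrable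
at zero because `γ < N`; outside it, `‖y‖ ^ (-γ) ≤ 1`. -/
theorem integrable_norm_rpow_mul_gaussKernel {γ t : ℝ} (hγ : 0 < γ) (hγN : γ < N) (ht : 0 < t)
    (x : RN N) : Integrable fun y : RN N => ‖y‖ ^ (-γ) * gaussKernel t (x - y) := by
  have hN : 0 < N := by exact_mod_cast hγ.trans hγN
  have : Nonempty (Fin N) := ⟨⟨0, hN⟩⟩
  have h1 : Integrable fun y : RN N => (Set.Iio (1 : ℝ)).indicator (fun r => r ^ (-γ)) ‖y‖ := by
    rw [integrable_fun_norm_addHaar volume (f := (Set.Iio (1 : ℝ)).indicator fun r => r ^ (-γ))]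
    have h2 : IntegrableOn (fun r : ℝ => r ^ ((N : ℝ) - 1 - γ)) (Set.Ioo 0 1) :=
      (intervalIntegral.integrableOn_Ioo_rpow_iff one_pos).2 (by linarith)
    have h3 : IntegrableOn ((Set.Iio (1 : ℝ)).indicator fun r => r ^ ((N : ℝ) - 1 - γ))
        (Set.Ioi 0) := by
      rw [integrableOn_indicator_iff measurableSet_Iio]
      rwa [Set.inter_comm, Set.Ioi_inter_Iio]
    refine h3.congr_fun (fun r hr => ?_) measurableSet_Ioi
    by_cases h : r ∈ Set.Iio (1 : ℝ)
    · simp only [Set.indicator_of_mem h, finrank_euclideanSpace, Fintype.card_fin, smul_eq_mul]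
      rw [← Real.rpow_natCast, ← Real.rpow_add hr, Nat.cast_sub hN]
      simp [sub_eq_add_neg]
    · simp only [Set.indicator_of_notMem h, smul_zero]
  refine ((h1.mul_const ((4 * Real.pi * t) ^ (-(N : ℝ) / 2))).add
    (integrable_gaussKernel_sub ht x)).mono' ?_ (ae_of_all _ fun y => ?_)
  · exact (Measurable.aestronglyMeasurable (measurable_norm.pow_const _)).mul
      (measurable_gaussKernel_sub t x).aestronglyMeasurable
  · have hG := gaussKernel_pos ht (x - y)
    have hn : 0 ≤ ‖y‖ ^ (-γ) := Real.rpow_nonneg (norm_nonneg y) _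
    have hc : 0 ≤ (4 * Real.pi * t) ^ (-(N : ℝ) / 2) := by positivity
    rw [Real.norm_of_nonneg (mul_nonneg hn hG.le)]
    simp only [Pi.add_apply]
    by_cases h : ‖y‖ ∈ Set.Iio (1 : ℝ)
    · rw [Set.indicator_of_mem h]
      have h2 : gaussKernel t (x - y) ≤ (4 * Real.pi * t) ^ (-(N : ℝ) / 2) := by
        refine mul_le_of_le_one_right hc (Real.exp_le_one_iff.2 ?_)
        rw [neg_div, neg_nonpos]
        positivity
      nlinarith [mul_le_mul_of_nonneg_left h2 hn]
    · rw [Set.indicator_of_notMem h, zero_mul, zero_add]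
      exact mul_le_of_le_one_left hG.le
        (Real.rpow_le_one_of_one_le_of_nonpos (not_lt.1 h) (by linarith))

/-- The homogeneous function `K y_1 ⋯ y_m |y|^{-γ-2m}`. -/
noncomputable def profile (J : Finset (Fin N)) (K γ : ℝ) (y : RN N) : ℝ :=
  K * (∏ i ∈ J, y i) * ‖y‖ ^ (-γ - 2 * (J.card : ℝ))

variable {J : Finset (Fin N)} {K γ : ℝ}

theorem measurable_profile : Measurable (profile J K γ) := by
  unfold profile
  refine Measurable.mul (measurable_const.mul (Finset.measurable_prod _ fun i _ => ?_))
    (measurable_norm.pow_const _)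
  fun_prop

theorem profile_nonneg (hK : 0 < K) {y : RN N} (hy : y ∈ orthant J) : 0 ≤ profile J K γ y :=
  mul_nonneg (mul_nonneg hK.le (Finset.prod_nonneg fun i hi => (hy i hi).le))
    (Real.rpow_nonneg (norm_nonneg y) _)

theorem continuousOn_profile : ContinuousOn (profile J K γ) {y | y ≠ 0} := by
  unfold profile
  refine ContinuousOn.mul (by fun_prop) ?_
  exact continuous_norm.continuousOn.rpow_const fun y hy => Or.inl (norm_ne_zero_iff.2 hy)

theorem orthant_smul_mem {l : ℝ} (hl : 0 < l) {y : RN N} (hy : y ∈ orthant J) :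
    l • y ∈ orthant J := fun i hi => mul_pos hl (hy i hi)

/-- The profile has degree `J.card - γ - 2 J.card = -(γ + J.card)`, so it is invariant under the
rescaling and bounds all rescaled copies of `f` at once. -/
theorem rpow_mul_profile_smul {l : ℝ} (hl : 0 < l) (y : RN N) :
    l ^ (γ + (J.card : ℝ)) * profile J K γ (l • y) = profile J K γ y := by
  unfold profile
  rw [norm_smul, Real.norm_of_nonneg hl.le, Real.mul_rpow hl.le (norm_nonneg y)]
  simp only [PiLp.smul_apply, smul_eq_mul]
  rw [Finset.prod_mul_distrib, Finset.prod_const, ← Real.rpow_natCast]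
  have : l ^ (γ + (J.card : ℝ)) * l ^ (J.card : ℝ) * l ^ (-γ - 2 * (J.card : ℝ)) = 1 := by
    rw [← Real.rpow_add hl, ← Real.rpow_add hl]
    ring_nf
    exact Real.rpow_zero l
  linear_combination (K * (∏ i ∈ J, y i) * ‖y‖ ^ (-γ - 2 * (J.card : ℝ))) * this

/-- One factor `∏ y_i` comes from the profile and one from the kernel. Each is at most
`|y|^{J.card}`, and together they absorb `|y|^{-2 J.card}`. -/
theorem profile_mul_orthantKernel_le (hK : 0 < K) {t : ℝ} (ht : 0 < t) {x y : RN N}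
    (hx : x ∈ orthant J) (hy : y ∈ orthant J) (hy0 : y ≠ 0) :
    profile J K γ y * orthantKernel J t x y
      ≤ K * (∏ i ∈ J, x i / t) * (‖y‖ ^ (-γ) * gaussKernel t (x - y)) := by
  have hy' := norm_pos_iff.2 hy0
  refine (mul_le_mul_of_nonneg_left (orthantKernel_le_prod_mul ht hx hy)
    (profile_nonneg hK hy)).trans ?_
  have h1 : ∏ i ∈ J, x i * y i / t = (∏ i ∈ J, x i / t) * ∏ i ∈ J, y i := by
    rw [← Finset.prod_mul_distrib]
    exact Finset.prod_congr rfl fun i _ => by ring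
  have h2 : ∏ i ∈ J, y i ≤ ‖y‖ ^ (J.card : ℝ) := by
    rw [Real.rpow_natCast, ← Finset.prod_const]
    exact Finset.prod_le_prod (fun i hi => (hy i hi).le) fun i _ =>
      (le_abs_self _).trans (PiLp.norm_apply_le y i)
  have h3 : 0 ≤ ∏ i ∈ J, y i := Finset.prod_nonneg fun i hi => (hy i hi).le
  have h4 : 0 ≤ ∏ i ∈ J, x i / t := Finset.prod_nonneg fun i hi => (div_pos (hx i hi) ht).le
  have h5 : (∏ i ∈ J, y i) * (∏ i ∈ J, y i) * ‖y‖ ^ (-γ - 2 * (J.card : ℝ)) ≤ ‖y‖ ^ (-γ) := by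
    refine (mul_le_mul_of_nonneg_right (mul_le_mul h2 h2 h3 (h3.trans h2))
      (Real.rpow_nonneg hy'.le _)).trans_eq ?_
    rw [← Real.rpow_add hy', ← Real.rpow_add hy']
    congr 1
    ring
  have h6 := mul_le_mul_of_nonneg_left h5
    (mul_nonneg (mul_nonneg hK.le h4) (gaussKernel_pos ht (x - y)).le)
  rw [h1, profile]
  linarith

theorem integrableOn_profile_mul_orthantKernel (hK : 0 < K) (hγ : 0 < γ) (hγN : γ < N) {t : ℝ}
    (ht : 0 < t) {x : RN N} (hx : x ∈ orthant J) :
    IntegrableOn (fun y => profile J K γ y * orthantKernel J t x y) (orthant J) := by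
  have hN : 0 < N := by exact_mod_cast hγ.trans hγN
  have : Nonempty (Fin N) := ⟨⟨0, hN⟩⟩
  refine ((integrable_norm_rpow_mul_gaussKernel hγ hγN ht x).const_mul
    (K * ∏ i ∈ J, x i / t)).integrableOn.mono'
    (measurable_profile.mul (continuous_orthantKernel J ht x).measurable).aestronglyMeasurable ?_
  have h0 : ∀ᵐ y : RN N, y ≠ 0 := by simp [ae_iff]
  filter_upwards [ae_restrict_of_ae h0, ae_restrict_mem (measurableSet_orthant J)] with y hy0 hy
  rw [Real.norm_of_nonneg (mul_nonneg (profile_nonneg hK hy) (orthantKernel_pos ht hx hy).le)]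
  exact profile_mul_orthantKernel_le hK ht hx hy hy0

/-- Convergence in the sense of distributions of functions with a common majorant `ψ` allows
testing against a kernel `A` for which `ψ A` is integrable. -/
theorem tendsto_setIntegral_mul_of_tendstoDistrib {m : ℕ} {g : ℕ → RN N → ℝ} {z ψ A : RN N → ℝ}
    (hlim : TendstoDistrib (sector N m) g z)
    (hA : ContDiff ℝ ((⊤ : ℕ∞) : WithTop ℕ∞) A) (hA0 : ∀ y ∈ sector N m, 0 ≤ A y)
    (hgm : ∀ n, AEStronglyMeasurable (g n)) (hzm : AEStronglyMeasurable z)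
    (hg : ∀ᶠ n in atTop, ∀ᵐ y, y ∈ sector N m → |g n y| ≤ ψ y)
    (hz : ∀ᵐ y, y ∈ sector N m → |z y| ≤ ψ y)
    (hψ : IntegrableOn (fun y => ψ y * A y) (sector N m)) :
    Tendsto (fun n => ∫ y in (sector N m : Set (RN N)), g n y * A y) atTop
      (𝓝 (∫ y in (sector N m : Set (RN N)), z y * A y)) := by
  set Ω : Set (RN N) := (sector N m : Set (RN N)) with hΩ
  set J := firstIdx N m
  have hΩm : MeasurableSet Ω := measurableSet_orthant J
  set χ := orthantCutoff J with hχ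
  have hχm : ∀ k, AEStronglyMeasurable (χ k) (volume.restrict Ω) :=
    fun k => (contDiff_orthantCutoff J k).continuous.aestronglyMeasurable
  have hχ1 : ∀ k y, |1 - χ k y| ≤ 1 := fun k y => by
    have h1 := orthantCutoff_nonneg J k y
    have h2 := orthantCutoff_le_one J k y
    rw [abs_le]
    constructor <;> linarith
  have hχ2 : ∀ k y, |χ k y| ≤ 1 := fun k y => by
    rw [abs_of_nonneg (orthantCutoff_nonneg J k y)]
    exact orthantCutoff_le_one J k y
  -- The error of inserting the cutoff is controlled by this tail, uniformly in `n` and also for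
  -- `z`; with the cutoff in place, the kernel becomes an admissible test function.
  have htail : Tendsto (fun k => ∫ y in Ω, ψ y * A y * (1 - χ k y)) atTop (𝓝 0) := by
    have h1 : Tendsto (fun k => ∫ y in Ω, ψ y * A y * (1 - χ k y)) atTop
        (𝓝 (∫ y in Ω, ψ y * A y * (1 - 1))) := by
      refine tendsto_integral_of_dominated_convergence (fun y => ‖ψ y * A y‖)
        (fun k => hψ.aestronglyMeasurable.mul (aestronglyMeasurable_const.sub (hχm k)))
        hψ.norm (fun k => ae_of_all _ fun y => ?_) ?_
      · rw [norm_mul]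
        exact mul_le_of_le_one_right (norm_nonneg _) (hχ1 k y)
      · filter_upwards [ae_restrict_mem hΩm] with y hy
        exact tendsto_const_nhds.mul (tendsto_const_nhds.sub (tendsto_orthantCutoff hy))
    simpa using h1
  have hAm : AEStronglyMeasurable A (volume.restrict Ω) := hA.continuous.aestronglyMeasurable
  have split : ∀ h : RN N → ℝ, AEStronglyMeasurable h →
      (∀ᵐ y, y ∈ sector N m → |h y| ≤ ψ y) → ∀ k,
      |(∫ y in Ω, h y * A y) - ∫ y in Ω, h y * (A y * χ k y)|
        ≤ ∫ y in Ω, ψ y * A y * (1 - χ k y) := by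
    intro h hm hb k
    have hb' : ∀ᵐ y ∂volume.restrict Ω, ‖h y * A y‖ ≤ ψ y * A y := by
      filter_upwards [ae_restrict_of_ae hb, ae_restrict_mem hΩm] with y h1 hy
      rw [norm_mul, Real.norm_of_nonneg (hA0 y hy)]
      exact mul_le_mul_of_nonneg_right (h1 hy) (hA0 y hy)
    have hi : IntegrableOn (fun y => h y * A y) Ω := hψ.mono' (hm.restrict.mul hAm) hb'
    have hi2 : IntegrableOn (fun y => h y * (A y * χ k y)) Ω := by
      have := Integrable.mul_bdd (c := 1) hi (hχm k) (ae_of_all _ fun y => hχ2 k y)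
      exact this.congr (ae_of_all _ fun y => mul_assoc _ _ _)
    rw [← integral_sub hi hi2, ← Real.norm_eq_abs]
    refine norm_integral_le_of_norm_le
      (Integrable.mul_bdd (c := 1) hψ (aestronglyMeasurable_const.sub (hχm k))
        (ae_of_all _ fun y => hχ1 k y)) ?_
    filter_upwards [hb'] with y hy
    have h1 : 0 ≤ 1 - χ k y := sub_nonneg.2 (orthantCutoff_le_one J k y)
    rw [show h y * A y - h y * (A y * χ k y) = h y * A y * (1 - χ k y) by ring, norm_mul,
      Real.norm_of_nonneg h1]
    exact mul_le_mul_of_nonneg_right hy h1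
  rw [Metric.tendsto_atTop]
  intro ε hε
  obtain ⟨k, hk⟩ := (htail.eventually (gt_mem_nhds (show (0 : ℝ) < ε / 3 by positivity))).exists
  let φ : TestFunction (sector N m) ℝ ⊤ :=
    ⟨fun y => A y * χ k y, hA.mul (contDiff_orthantCutoff J k),
      (hasCompactSupport_orthantCutoff J k).mul_left,
      (tsupport_mul_subset_right (f := A)).trans (tsupport_orthantCutoff_subset_orthant J k)⟩
  have hφ := Metric.tendsto_atTop.1 (hlim φ) (ε / 3) (by positivity)
  obtain ⟨n₁, hn₁⟩ := hφ
  obtain ⟨n₂, hn₂⟩ := eventually_atTop.1 hg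
  refine ⟨max n₁ n₂, fun n hn => ?_⟩
  have h1 := hn₁ n ((le_max_left _ _).trans hn)
  have h2 := split (g n) (hgm n) (hn₂ n ((le_max_right _ _).trans hn)) k
  have h3 := split z hzm hz k
  change dist (∫ y in Ω, g n y * (A y * χ k y)) (∫ y in Ω, z y * (A y * χ k y)) < ε / 3 at h1
  rw [Real.dist_eq] at h1 ⊢
  rw [abs_lt] at h1 ⊢
  rw [abs_le] at h2 h3
  constructor <;> linarith

end Profile

/-! ### Bounds for the limit `z`, scaling, and positivity of `e^{tΔ}z` -/

section LimitProfile

theorem integrable_mul_of_hasCompactSupport {E : Type*} [NormedAddCommGroup E]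
    [MeasurableSpace E] [BorelSpace E] {μ : Measure E} {U : Set E} {h φ : E → ℝ}
    (hh : LocallyIntegrableOn h U μ) (hφ : Continuous φ) (hφc : HasCompactSupport φ)
    (hφU : tsupport φ ⊆ U) : Integrable (fun x => φ x * h x) μ := by
  have h1 := (hh.integrableOn_compact_subset hφU hφc).continuousOn_mul hφ.continuousOn hφc
  refine (integrableOn_iff_integrable_of_support_subset fun x hx => ?_).1 h1
  exact subset_tsupport φ (left_ne_zero_of_mul hx)

variable {N : ℕ}

/-- Order bounds pass to limits in the sense of distributions. -/
theorem ae_nonneg_and_le_of_tendstoDistrib [Nonempty (Fin N)] {m : ℕ} {g : ℕ → RN N → ℝ}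
    {z ψ : RN N → ℝ} (hlim : TendstoDistrib (sector N m) g z)
    (hz : LocallyIntegrableOn z {x | x ≠ 0}) (hψ : ContinuousOn ψ {x | x ≠ 0})
    (hgm : ∀ n, AEStronglyMeasurable (g n))
    (hg : ∀ᶠ n in atTop, ∀ᵐ y, y ∈ sector N m → 0 ≤ g n y ∧ g n y ≤ ψ y) :
    ∀ᵐ y, y ∈ sector N m → 0 ≤ z y ∧ z y ≤ ψ y := by
  have h0 : IsOpen {x : RN N | x ≠ 0} := isOpen_ne
  -- The origin is removed because `z` is locally integrable and `ψ` continuous only away from it;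
  -- when `m = 0` it lies in the sector.
  set Ω : Set (RN N) := (sector N m : Set (RN N)) with hΩ
  have hΩm : MeasurableSet Ω := (sector N m).isOpen.measurableSet
  have hU : IsOpen (Ω ∩ {x | x ≠ 0}) := (sector N m).isOpen.inter h0
  have hz' : LocallyIntegrableOn z (Ω ∩ {x | x ≠ 0}) := hz.mono_set Set.inter_subset_right
  have hψ' : LocallyIntegrableOn ψ (Ω ∩ {x | x ≠ 0}) :=
    (hψ.mono Set.inter_subset_right).locallyIntegrableOn hU.measurableSet
  have hset : ∀ φ h : RN N → ℝ, tsupport φ ⊆ Ω ∩ {x | x ≠ 0} →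
      ∫ x, φ x * h x = ∫ x in Ω, h x * φ x := by
    intro φ h hφ
    simp_rw [mul_comm (h _)]
    refine (setIntegral_eq_integral_of_forall_compl_eq_zero fun x hx => ?_).symm
    rw [image_eq_zero_of_notMem_tsupport fun hc => hx (hφ hc).1, zero_mul]
  have hlim' : ∀ φ : RN N → ℝ, ContDiff ℝ ((⊤ : ℕ∞) : WithTop ℕ∞) φ → HasCompactSupport φ →
      tsupport φ ⊆ Ω ∩ {x | x ≠ 0} →
      Tendsto (fun n => ∫ x in Ω, g n x * φ x) atTop (𝓝 (∫ x in Ω, z x * φ x)) :=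
    fun φ hφ hφc hφU => hlim ⟨φ, hφ, hφc, hφU.trans Set.inter_subset_left⟩
  have hlow := ae_nonneg_of_integral_contDiff_mul_nonneg hU hz' fun φ hφ hφc hφU hφ0 => by
    rw [hset φ z hφU]
    refine ge_of_tendsto (hlim' φ hφ hφc hφU) ?_
    filter_upwards [hg] with n hn
    refine integral_nonneg_of_ae ?_
    filter_upwards [ae_restrict_of_ae hn, ae_restrict_mem hΩm] with y h1 hy
    exact mul_nonneg (h1 hy).1 (hφ0 y)
  have hupp := ae_nonneg_of_integral_contDiff_mul_nonneg hU (hψ'.sub hz') fun φ hφ hφc hφU hφ0 => by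
    have hi1 := integrable_mul_of_hasCompactSupport hψ' hφ.continuous hφc hφU
    have hi2 := integrable_mul_of_hasCompactSupport hz' hφ.continuous hφc hφU
    simp only [Pi.sub_apply, mul_sub]
    rw [integral_sub hi1 hi2, hset φ z hφU, hset φ ψ hφU, sub_nonneg]
    refine le_of_tendsto (hlim' φ hφ hφc hφU) ?_
    filter_upwards [hg] with n hn
    have hi3 : IntegrableOn (fun y => ψ y * φ y) Ω := by
      simpa only [mul_comm] using hi1.integrableOn (s := Ω)
    have hle : ∀ᵐ y ∂volume.restrict Ω, 0 ≤ g n y ∧ g n y ≤ ψ y := by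
      filter_upwards [ae_restrict_of_ae hn, ae_restrict_mem hΩm] with y h1 hy using h1 hy
    refine integral_mono_ae (hi3.mono' ((hgm n).restrict.mul
      hφ.continuous.aestronglyMeasurable) ?_) hi3 ?_
    · filter_upwards [hle] with y hy
      rw [Real.norm_of_nonneg (mul_nonneg hy.1 (hφ0 y))]
      exact mul_le_mul_of_nonneg_right hy.2 (hφ0 y)
    · filter_upwards [hle] with y hy
      exact mul_le_mul_of_nonneg_right hy.2 (hφ0 y)
  have hne : ∀ᵐ y : RN N, y ≠ 0 := by simp [ae_iff]
  filter_upwards [hlow, hupp, hne] with y h1 h2 h3 hy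
  exact ⟨h1 ⟨hy, h3⟩, sub_nonneg.1 (h2 ⟨hy, h3⟩)⟩

theorem gaussKernel_sq_smul {l : ℝ} (hl : 0 < l) (x : RN N) :
    gaussKernel (l ^ 2) (l • x) = (l ^ N)⁻¹ * gaussKernel 1 x := by
  unfold gaussKernel
  rw [norm_smul, Real.norm_of_nonneg hl.le, mul_one, Real.mul_rpow (by positivity) (by positivity),
    ← Real.rpow_natCast l 2, ← Real.rpow_mul hl.le, ← Real.rpow_natCast l N, ← Real.rpow_neg hl.le,
    show ((2 : ℕ) : ℝ) * (-(N : ℝ) / 2) = -(N : ℝ) by push_cast; ring, mul_comm (_ ^ _) (l ^ _),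
    mul_assoc]
  congr 3
  rw [Nat.cast_two, Real.rpow_two]
  field_simp

/-- The heat semigroup commutes with parabolic dilations. -/
theorem heat_sq_smul {l : ℝ} (hl : 0 < l) (f : RN N → ℝ) (x : RN N) :
    heat (l ^ 2) f (l • x) = heat 1 (dilate l f) x := by
  unfold heat dilate
  have h := Measure.integral_comp_smul (volume : Measure (RN N))
    (fun y => gaussKernel (l ^ 2) (l • x - y) * f y) l
  simp only [← smul_sub, gaussKernel_sq_smul hl, mul_assoc, integral_const_mul, smul_eq_mul,
    finrank_euclideanSpace, Fintype.card_fin] at h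
  have hc : |(l ^ N)⁻¹| = (l ^ N)⁻¹ := abs_of_nonneg (by positivity)
  rw [hc] at h
  exact (mul_left_cancel₀ (inv_ne_zero (pow_ne_zero N hl.ne')) h).symm

theorem heat_mono_of_antiSymm {J : Finset (Fin N)} {t A B : ℝ} (ht : 0 < t) {f g : RN N → ℝ}
    (hf : ∀ i ∈ J, ∀ x, f (reflect {i} x) = -f x) (hg : ∀ i ∈ J, ∀ x, g (reflect {i} x) = -g x)
    (hfm : AEStronglyMeasurable f) (hgm : AEStronglyMeasurable g) (hA : ∀ y, |f y| ≤ A)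
    (hB : ∀ y, |g y| ≤ B) (hfg : ∀ y ∈ orthant J, f y ≤ g y) {x : RN N} (hx : x ∈ orthant J) :
    heat t f x ≤ heat t g x := by
  rw [heat_eq_setIntegral_orthant ht hf hfm hA, heat_eq_setIntegral_orthant ht hg hgm hB]
  exact setIntegral_mono_on (integrableOn_orthantKernel_mul ht hx hfm hA)
    (integrableOn_orthantKernel_mul ht hx hgm hB) (measurableSet_orthant J) fun y hy =>
      mul_le_mul_of_nonneg_left (hfg y hy) (orthantKernel_pos ht hx hy).le

theorem card_firstIdx {m : ℕ} (hm : m ≤ N) : (firstIdx N m).card = m := by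
  simp [firstIdx, Fin.card_filter_val_lt, hm]

/-- The kernel is strictly positive on the orthant, so a zero value would force `z = 0` almost
everywhere there, and then everywhere by anti-symmetry. -/
theorem heatDistrib_pos {m : ℕ} {t : ℝ} {z : RN N → ℝ} (ht : 0 < t) (hz0 : ¬ z =ᵐ[volume] 0)
    (hz : AEAntiSymm m z) (hpos : ∀ᵐ y, y ∈ sector N m → 0 ≤ z y) {x : RN N}
    (hx : x ∈ sector N m)
    (hi : IntegrableOn (fun y => z y * orthantKernel (firstIdx N m) t x y)
      (orthant (firstIdx N m))) : 0 < heatDistrib m t z x := by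
  have hΩm := measurableSet_orthant (firstIdx N m)
  have hnn : 0 ≤ᵐ[volume.restrict (orthant (firstIdx N m))]
      fun y => z y * orthantKernel (firstIdx N m) t x y := by
    filter_upwards [ae_restrict_of_ae hpos, ae_restrict_mem hΩm] with y h1 hy
    exact mul_nonneg (h1 hy) (orthantKernel_pos ht hx hy).le
  rw [heatDistrib_eq]
  refine lt_of_le_of_ne (integral_nonneg_of_ae hnn) fun h => hz0 ?_
  have h1 := (integral_eq_zero_iff_of_nonneg_ae hnn hi).1 h.symm
  refine ae_eq_zero_of_ae_orthant hz ?_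
  filter_upwards [(ae_restrict_iff' hΩm).1 h1] with y h2 hy
  exact (mul_eq_zero.1 (h2 hy)).resolve_right (orthantKernel_pos ht hx hy).ne'

/-- The supremum of `|e^{tΔ} z|` is approached in the sector. -/
theorem exists_mem_sector_lt_abs_heatDistrib {m : ℕ} {t c : ℝ} {z : RN N → ℝ} (ht : 0 < t)
    (hc : 0 ≤ c) (h : ENNReal.ofReal c < eLpNorm (heatDistrib m t z) ∞ volume) :
    ∃ x ∈ sector N m, c < |heatDistrib m t z x| := by
  by_contra hcon
  push Not at hcon
  refine h.not_ge ?_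
  have hle : ∀ x : RN N, |heatDistrib m t z x| ≤ c := by
    intro x
    -- Off the walls, reflecting `x` into the sector changes only the sign; on a wall the kernel
    -- vanishes identically.
    by_cases hx : ∀ i ∈ firstIdx N m, x i ≠ 0
    · obtain ⟨x', hx', ε, hε, he⟩ := exists_orthantKernel_eq_sign_mul (firstIdx N m) ht x hx
      refine le_trans (le_of_eq ?_) (hcon x' hx')
      rw [heatDistrib_eq, heatDistrib_eq]
      simp_rw [he, mul_left_comm _ ε]
      rw [integral_const_mul, abs_mul, hε, one_mul]
    · push Not at hx
      obtain ⟨i, hi, hxi⟩ := hx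
      have : ∀ y, orthantKernel (firstIdx N m) t x y = 0 := fun y => by
        rw [orthantKernel_eq_prod _ ht, Finset.prod_eq_zero (Finset.mem_univ i), mul_zero]
        simp [kernelFactor, hi, hxi]
      simpa [heatDistrib_eq, this] using hc
  rw [eLpNorm_exponent_top]
  refine eLpNormEssSup_le_of_ae_bound (ae_of_all _ hle)

end LimitProfile

/-! ### Contradiction by scaling -/

theorem mainTheorem7 (N m : ℕ) (α γ : ℝ) (hm : m ≤ N) (hγ : 0 < γ) (hγN : γ < N)
    (hα : 0 < α) (hαc : α ≤ 2 / (γ + m))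
    (u₀ f : C₀(RN N, ℝ))
    (hu₀ : AntiSymm m u₀) (hf : AntiSymm m f)
    (hf_nonneg : ∀ x ∈ sector N m, 0 ≤ f x)
    (hf_le : ∀ x ∈ sector N m, f x ≤ u₀ x)
    (K : ℝ) (hK : 0 < K)
    (hf_bound : ∀ x ∈ sector N m, x ≠ 0 →
      f x ≤ K * (∏ i ∈ firstIdx N m, x i) * ‖x‖ ^ (-γ - 2 * (m : ℝ)))
    (lam : ℕ → ℝ) (hlam : Tendsto lam atTop atTop)
    (z : RN N → ℝ) (hz_loc : LocallyIntegrableOn z {x | x ≠ 0} volume)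
    (hz_ne : ¬ (z =ᵐ[volume] 0)) (hz : AEAntiSymm m z)
    (hlim : TendstoDistrib (sector N m)
      (fun n x => lam n ^ (γ + (m : ℝ)) * dilate (lam n) f x) z)
    (hcrit : α = 2 / (γ + m) →
      ENNReal.ofReal ((1 / α) ^ (1 / α)) < eLpNorm (heatDistrib m 1 z) ∞ volume) :
    maximalTime 1 α u₀ < ∞ := by
  have hN : 0 < N := by exact_mod_cast hγ.trans hγN
  have : Nonempty (Fin N) := ⟨⟨0, hN⟩⟩
  have hγm : 0 < γ + (m : ℝ) := by positivity
  set J := firstIdx N m with hJ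
  have hcard : (J.card : ℝ) = m := by rw [hJ, card_firstIdx hm]
  have hbd : ∀ h : C₀(RN N, ℝ), ∀ y, |h y| ≤ ‖h‖ := fun h y => h.toBCF.norm_coe_le_norm y
  set g : ℕ → RN N → ℝ := fun n x => lam n ^ (γ + (m : ℝ)) * dilate (lam n) f x with hg
  have hdc : ∀ l, Continuous (dilate l f) := fun l => f.continuous.comp (continuous_const_smul l)
  have hgm : ∀ n, AEStronglyMeasurable (g n) := fun n =>
    (continuous_const.mul (hdc _)).aestronglyMeasurable
  have hne : ∀ᵐ y : RN N, y ≠ 0 := by simp [ae_iff]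
  have hgb : ∀ᶠ n in atTop, ∀ᵐ y, y ∈ sector N m → 0 ≤ g n y ∧ g n y ≤ profile J K γ y := by
    filter_upwards [hlam.eventually_gt_atTop 0] with n hn
    filter_upwards [hne] with y hy0 hy
    have hpos : 0 ≤ lam n ^ (γ + (m : ℝ)) := Real.rpow_nonneg hn.le _
    have hmem : lam n • y ∈ sector N m := orthant_smul_mem hn hy
    refine ⟨mul_nonneg hpos (hf_nonneg _ hmem), ?_⟩
    rw [← rpow_mul_profile_smul hn y, hcard, profile, hcard]
    exact mul_le_mul_of_nonneg_left (hf_bound _ hmem (smul_ne_zero hn.ne' hy0)) hpos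
  -- No pointwise bound on `z` is assumed; sign and majorant are inherited from the rescaled `f`.
  have hzb := ae_nonneg_and_le_of_tendstoDistrib hlim hz_loc continuousOn_profile hgm hgb
  have hzm : AEStronglyMeasurable z := by
    have h1 := hz_loc.aestronglyMeasurable
    rwa [Measure.restrict_eq_self_of_ae_mem (s := {x : RN N | x ≠ 0}) hne] at h1
  have hgb' : ∀ᶠ n in atTop, ∀ᵐ y, y ∈ sector N m → |g n y| ≤ profile J K γ y := by
    filter_upwards [hgb] with n hn
    filter_upwards [hn] with y h1 hy
    rw [abs_of_nonneg (h1 hy).1]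
    exact (h1 hy).2
  have hzb' : ∀ᵐ y, y ∈ sector N m → |z y| ≤ profile J K γ y := by
    filter_upwards [hzb] with y h1 hy
    rw [abs_of_nonneg (h1 hy).1]
    exact (h1 hy).2
  have hpos : ∀ x ∈ sector N m, 0 < heatDistrib m 1 z x := by
    intro x hx
    refine heatDistrib_pos one_pos hz_ne hz (hzb.mono fun y h1 hy => (h1 hy).1) hx ?_
    refine (integrableOn_profile_mul_orthantKernel hK hγ hγN one_pos hx).mono'
      (hzm.restrict.mul (continuous_orthantKernel J one_pos x).aestronglyMeasurable) ?_
    filter_upwards [ae_restrict_of_ae hzb', ae_restrict_mem (measurableSet_orthant J)] with y h1 hy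
    rw [norm_mul, Real.norm_of_nonneg (orthantKernel_pos one_pos hx hy).le]
    exact mul_le_mul_of_nonneg_right (h1 hy) (orthantKernel_pos one_pos hx hy).le
  obtain ⟨x, hx, hxc⟩ : ∃ x ∈ sector N m,
      α = 2 / (γ + m) → (1 / α) ^ (1 / α) < heatDistrib m 1 z x := by
    by_cases hc : α = 2 / (γ + m)
    · obtain ⟨x, hx, h1⟩ := exists_mem_sector_lt_abs_heatDistrib one_pos
        (by positivity) (hcrit hc)
      rw [abs_of_pos (hpos x hx)] at h1
      exact ⟨x, hx, fun _ => h1⟩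
    -- Below the critical exponent any point of the sector works, since only `L > 0` is needed.
    · exact ⟨WithLp.toLp 2 fun _ => 1, fun i _ => one_pos, fun h => absurd h hc⟩
  have hL := hpos x hx
  set L := heatDistrib m 1 z x
  have hlimL : Tendsto (fun n => ∫ y in orthant J, g n y * orthantKernel J 1 x y) atTop (𝓝 L) :=
    tendsto_setIntegral_mul_of_tendstoDistrib hlim (contDiff_orthantKernel J one_pos x)
      (fun y hy => (orthantKernel_pos one_pos hx hy).le) hgm hzm hgb' hzb'
      (integrableOn_profile_mul_orthantKernel hK hγ hγN one_pos hx)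
  set c : ℕ → ℝ := fun n => ∫ y in orthant J, g n y * orthantKernel J 1 x y with hc
  have hδ : 0 ≤ 2 - (γ + m) * α := by
    have := (le_div_iff₀ hγm).1 hαc
    linarith
  have hcα : Tendsto (fun n => α * c n ^ α) atTop (𝓝 (α * L ^ α)) :=
    (hlimL.rpow_const (Or.inr hα.le)).const_mul α
  -- In the critical case the exponent is zero and `L > (1/α)^{1/α}` means `α L^α > 1`; otherwise a
  -- diverging power multiplies a positive limit.
  have hev : ∀ᶠ n in atTop, 1 < lam n ^ (2 - (γ + m) * α) * (α * c n ^ α) := by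
    rcases hδ.eq_or_lt with h | h
    · have hαe : α = 2 / (γ + m) := by
        rw [eq_div_iff hγm.ne']
        linarith
      have h1 := Real.rpow_lt_rpow (by positivity) (hxc hαe) hα
      rw [← Real.rpow_mul (by positivity), one_div_mul_cancel hα.ne', Real.rpow_one,
        div_lt_iff₀' hα] at h1
      filter_upwards [hcα.eventually (lt_mem_nhds h1)] with n hn
      rwa [← h, Real.rpow_zero, one_mul]
    · have h1 : 0 < α * L ^ α := by positivity
      exact (((tendsto_rpow_atTop h).comp hlam).atTop_mul_pos h1 hcα).eventually_gt_atTop 1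
  obtain ⟨n, hn1, hn0, hcn⟩ := (hev.and ((hlam.eventually_gt_atTop 0).and
    (hlimL.eventually (lt_mem_nhds hL)))).exists
  -- For the chosen `n`, every existence time is shown to be at most `λ_n²`.
  refine lt_of_le_of_lt (sSup_le ?_) (ENNReal.ofReal_lt_top (r := lam n ^ 2))
  rintro T ⟨u, hu⟩
  by_contra! hT
  have hl2 : 0 < lam n ^ 2 := by positivity
  have hxl : lam n • x ∈ sector N m := orthant_smul_mem hn0 hx
  have hmain := hu.mul_rpow_heat_le_one hα hl2 hT hu₀
    (fun y hy => (hf_nonneg y hy).trans (hf_le y hy)) hxl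
  have hmono : heat (lam n ^ 2) f (lam n • x) ≤ heat (lam n ^ 2) u₀ (lam n • x) :=
    heat_mono_of_antiSymm (J := J) hl2 hf hu₀ f.continuous.aestronglyMeasurable
      u₀.continuous.aestronglyMeasurable (hbd f) (hbd u₀) hf_le hxl
  have hcf : c n = lam n ^ (γ + (m : ℝ)) * heat (lam n ^ 2) f (lam n • x) := by
    rw [heat_sq_smul hn0, heat_eq_setIntegral_orthant (J := J) one_pos
      (fun i hi y => by
        unfold dilate
        rw [← reflect_smul]
        exact hf i hi _)
      (hdc _).aestronglyMeasurable (fun y => hbd f _), ← integral_const_mul]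
    simp only [hc, hg]
    congr 1
    funext y
    ring
  have hp : 0 < lam n ^ (γ + (m : ℝ)) := Real.rpow_pos_of_pos hn0 _
  have hle : c n ^ α ≤ lam n ^ ((γ + m) * α) * heat (lam n ^ 2) u₀ (lam n • x) ^ α := by
    have h0 : 0 ≤ heat (lam n ^ 2) u₀ (lam n • x) :=
      (pos_of_mul_pos_right (hcf ▸ hcn) hp.le).le.trans hmono
    rw [Real.rpow_mul hn0.le, ← Real.mul_rpow hp.le h0, hcf]
    exact Real.rpow_le_rpow (hcf ▸ hcn.le) (mul_le_mul_of_nonneg_left hmono hp.le) hα.le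
  have hsplit : lam n ^ (2 - (γ + m) * α) * lam n ^ ((γ + m) * α) = lam n ^ 2 := by
    rw [← Real.rpow_add hn0, sub_add_cancel, Real.rpow_two]
  -- By `hsplit`, this bounds the quantity exceeding one in `hn1` by `α λ_n² (e^{λ_n²Δ}u₀(λ_n
  -- x))^α`, which `hmain` bounds by one.
  have h3 := mul_le_mul_of_nonneg_left (mul_le_mul_of_nonneg_left hle hα.le)
    (Real.rpow_nonneg hn0.le (2 - (γ + m) * α))
  have h4 : lam n ^ (2 - (γ + m) * α) * (α * (lam n ^ ((γ + m) * α)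
      * heat (lam n ^ 2) u₀ (lam n • x) ^ α)) = α * lam n ^ 2
      * heat (lam n ^ 2) u₀ (lam n • x) ^ α := by
    rw [← hsplit]
    ring
  linarith
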